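/- Let $\Pi'$ be the set of all partitions of $\{1,2,\dots\}$ into finitely many blocks, ordered by $\pi\le\sigma$ if every block of $\sigma$ is contained in a block of $\pi$, and let $\Pi'_{n+1}$ be the set of partitions of $\{1,\dots,n+1\}$, ordered in the same way. In a poset, $\rho(x)$ denotes the largest $k$ for which there is a chain $x_0<x_1<\dots<x_k=x$, and $\langle x\rangle=\{z : z\le x\}$. Let $r_{n,k}$ be the number of $z\le x$ with $\rho(z)=k$, where $x\in\Pi'$ is any element with $\rho(x)=n$. Let $(R_{n,k}(t))_{0\le k\le n}$ be the unique monic polynomials such that $R_{n,0}(t)=\sum_{k=0}^n r_{n,k}t^k$, $R_{n,n}(t)=t^n$, $t^k$ divides $R_{n,k}(t)$, and $R_{n+1,k}(t)=R_{n+1,k+1}(t)+\lambda_{n,k}R_{n,k}(t)$ for all $0\le k\le n$, for some real numbers $\lambda_{n,k}\ge 0$ for which $\lambda_{n,k}=0$ implies $\lambda_{n+1,k}=0$. A \emph{partition poset} is a poset $P$ with a least element such that for each $x\in P$ there is $y\in\Pi'$ with $\langle x\rangle\cong\langle y\rangle$. Let $P$ be a finite partition poset that is \emph{pure}, that is, all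 its maximal elements (facets) have the same rank $n$. The \emph{$h$-vector} of $P$ is the vector $(h_0,\dots,h_n)$ of real numbers with $\sum_{x\in P}t^{\rho(x)}=\sum_{k=0}^n h_k R_{n,k}(t)$. A finite graph is \emph{chordal} if it has no vertices, or has a vertex $v$ whose neighbours form a clique and whose removal leaves a chordal graph. A total order $F_1,\dots,F_m$ of the facets of $P$ is a \emph{shelling} if for each $1<k\le m$, with $I_k=(\langle F_1\rangle\cup\dots\cup\langle F_{k-1}\rangle)\cap\langle F_k\rangle$, (i) $I_k$ is pure of rank $n-1$, and (ii) the graph on $\{1,\dots,n+1\}$ in which $i\ne j$ are adjacent if and only if the partition whose only non-singleton block is $\{i,j\}$ belongs to $I_k$, under an identification of $\langle F_k\rangle$ with $\Pi'_{n+1}$, is chordal. $P$ is \emph{shellable} if it has a shelling. The \emph{chain polynomial} of a finite poset $Q$ is $\sum_C t^{|C|}$, the sum being over all chains $C$ of $Q$ (including the empty one). Theorem. Let $P$ be a finite pure partition poset. If $P$ is shellable, then $P$ has a unique $h$-vector and its entries are nonnegative, and the chain polynomials of $P$ and of all its rank selected subposets $P_S=\{x\in P:\rho(x)\in S\}$,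 $S\subseteq\mathbb{N}$, are real-rooted. -/

import Mathlib

open Polynomial

noncomputable section

namespace PartitionPoset

/-- The quasi-rank of `x`: the largest `k` such that there is a chain `x₀ < x₁ < ⋯ < x_k = x`.
It is the rank function in a graded poset. All posets used below have finite principal order
ideals, so that `Order.height` is finite. -/
def rk {Q : Type*} [PartialOrder Q] (x : Q) : ℕ := (Order.height x).toNat

/-- The rank of a (finite) poset: the largest rank of an element. -/
def rank (Q : Type*) [PartialOrder Q] : ℕ := sSup (Set.range (rk : Q → ℕ))

/-- A finite poset is pure if all its maximal elements have the same rank. -/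
def IsPure (Q : Type*) [PartialOrder Q] : Prop :=
  ∀ x y : Q, IsMax x → IsMax y → rk x = rk y

/-- The rank generating polynomial `∑ x, t ^ ρ(x)` of a finite poset. -/
def rankGenPoly (Q : Type*) [PartialOrder Q] [Finite Q] : ℝ[X] :=
  ∑ᶠ x : Q, (X : ℝ[X]) ^ rk x

/-- The chain polynomial `∑ C, t ^ |C|` of a finite poset, over all chains, the empty one
included. -/
def chainPoly (Q : Type*) [PartialOrder Q] [Finite Q] : ℝ[X] :=
  ∑ᶠ C : {C : Finset Q // IsChain (· ≤ ·) (C : Set Q)}, (X : ℝ[X]) ^ C.1.card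

/-- The rank selected subposet `Q_S` of all elements whose rank lies in `S`. -/
abbrev RankSelected (Q : Type*) [PartialOrder Q] (S : Set ℕ) : Type _ := {x : Q // rk x ∈ S}

/-- The dual partition lattice of the partitions of `α` (given as equivalence relations, the
blocks being the classes): `π ≤ σ` if every block of `σ` is contained in a block of `π`. -/
abbrev DualPartitions (α : Type*) : Type _ := (Setoid α)ᵒᵈ

/-- The infinite dual partition lattice: the partitions of `{1, 2, …}` into finitely many
blocks, with `π ≤ σ` if every block of `σ` is contained in a block of `π`. -/
abbrev InfDualPartitions : Type := {π : DualPartitions ℕ+ // Finite (Quotient (OrderDual.ofDual π))}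

/-- `Q` is an `A`-poset: every principal order ideal of `Q` is isomorphic to a principal order
ideal of `A`. -/
def IsPosetOver (A Q : Type*) [PartialOrder A] [PartialOrder Q] : Prop :=
  ∀ x : Q, ∃ y : A, Nonempty (Set.Iic x ≃o Set.Iic y)

/-- A partition poset: a poset all of whose principal order ideals are isomorphic to principal
order ideals of the infinite dual partition lattice. -/
def IsPartitionPoset (Q : Type*) [PartialOrder Q] : Prop := IsPosetOver InfDualPartitions Q

open Classical in
/-- The matrix `R(A) = (r_{n,k})` of a rank uniform poset `A`: the number `r_{n,k}` of elements
of rank `k` below a fixed element of rank `n`. -/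
def rankMatrix (A : Type*) [PartialOrder A] (n k : ℕ) : ℕ :=
  if h : ∃ x : A, rk x = n then Set.ncard {z : A | z ≤ h.choose ∧ rk z = k} else 0

/-- The polynomials `Rp n k`, `k ≤ n`, resolve the infinite lower triangular matrix `r` with
unit diagonal. The condition `vanish` is the normalization that makes them unique. -/
structure ResolvesWith (r : ℕ → ℕ → ℝ) (Rp : ℕ → ℕ → ℝ[X]) (lam : ℕ → ℕ → ℝ) : Prop where
  nonneg : ∀ n k, k ≤ n → 0 ≤ lam n k
  monic : ∀ n k, k ≤ n → (Rp n k).Monic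
  row : ∀ n, Rp n 0 = ∑ k ∈ Finset.range (n + 1), C (r n k) * X ^ k
  diag : ∀ n, Rp n n = X ^ n
  dvd : ∀ n k, k ≤ n → X ^ k ∣ Rp n k
  step : ∀ n k, k ≤ n → Rp (n + 1) k = Rp (n + 1) (k + 1) + C (lam n k) * Rp n k
  vanish : ∀ n k, k ≤ n → lam n k = 0 → lam (n + 1) k = 0

/-- The polynomials `Rp n k` resolve the matrix `r`. -/
def Resolves (r : ℕ → ℕ → ℝ) (Rp : ℕ → ℕ → ℝ[X]) : Prop := ∃ lam, ResolvesWith r Rp lam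

/-- `h` is the `h`-vector of the partition poset `P` of rank `n`: the rank generating polynomial
of `P` is `∑ k ≤ n, h_k R_{n,k}(t)`, where the `R_{n,k}` resolve the matrix of the infinite dual
partition lattice. -/
def IsHVector (P : Type*) [PartialOrder P] [Finite P] (h : Fin (rank P + 1) → ℝ) : Prop :=
  ∃ Rp : ℕ → ℕ → ℝ[X], Resolves (fun n k => (rankMatrix InfDualPartitions n k : ℝ)) Rp ∧
    rankGenPoly P = ∑ k : Fin (rank P + 1), C (h k) * Rp (rank P) k

/-- The subgraph of `G` induced on the finite vertex set `s` is chordal: `s` is empty, or `s` has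
a vertex `v` whose neighbours in `s` form a clique and whose removal leaves a chordal graph. -/
inductive IsChordalOn {V : Type*} (G : SimpleGraph V) : Finset V → Prop
  | empty : IsChordalOn G ∅
  | cons (v : V) (s : Finset V) (hv : v ∉ s) (hclique : G.IsClique {w | w ∈ s ∧ G.Adj v w})
      (hs : IsChordalOn G s) : IsChordalOn G (Finset.cons v s hv)

/-- A finite graph is chordal. -/
def IsChordal {V : Type*} [Fintype V] (G : SimpleGraph V) : Prop := IsChordalOn G Finset.univ

/-- The partition of `α` whose only block that may have more than one element is `{i, j}`. -/
def pairPartition {α : Type*} (i j : α) : DualPartitions α :=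
  OrderDual.toDual
    { r := fun a b => a = b ∨ (a ∈ ({i, j} : Set α) ∧ b ∈ ({i, j} : Set α))
      iseqv :=
        { refl := fun _ => Or.inl rfl
          symm := by
            rintro a b (h | ⟨h, h'⟩)
            · exact Or.inl h.symm
            · exact Or.inr ⟨h', h⟩
          trans := by
            rintro a b c (rfl | ⟨h, h'⟩) (rfl | ⟨k, k'⟩)
            · exact Or.inl rfl
            · exact Or.inr ⟨k, k'⟩
            · exact Or.inr ⟨h, h'⟩
            · exact Or.inr ⟨h, k'⟩ } }

theorem pairPartition_comm {α : Type*} (i j : α) : pairPartition i j = pairPartition j i := by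
  unfold pairPartition
  simp only [Set.pair_comm i j]

/-- The graph of a subset `I` of `P` relative to an identification `φ` of the principal order
ideal of `F` with the lattice of partitions of `V`: `i` and `j` are adjacent if the partition
with the single non-singleton block `{i, j}` corresponds to an element of `I`. -/
def idealGraph {P V : Type*} [PartialOrder P] {F : P} (φ : Set.Iic F ≃o DualPartitions V)
    (I : Set P) : SimpleGraph V where
  Adj i j := i ≠ j ∧ (φ.symm (pairPartition i j) : P) ∈ I
  symm := ⟨by
    rintro i j ⟨h, h'⟩
    exact ⟨h.symm, by rwa [pairPartition_comm]⟩⟩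
  loopless := ⟨fun _ h => h.1 rfl⟩

/-- The union of the principal order ideals of the facets that precede `F k`. -/
def idealBefore {P : Type*} [PartialOrder P] {m : ℕ} (F : Fin m → P) (k : Fin m) : Set P :=
  {x | ∃ j, j < k ∧ x ≤ F j}

/-- `F` lists the facets (maximal elements) of `P` in the order of a shelling: for every facet
`F k` but the first, its intersection with the ideal of the earlier facets is pure of rank one
less than `P`, and its graph is chordal. -/
structure IsShelling {P : Type*} [PartialOrder P] {m : ℕ} (F : Fin m → P) : Prop where
  injective : Function.Injective F
  range_eq : Set.range F = {x | IsMax x}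
  pure : ∀ k : Fin m, 0 < (k : ℕ) →
    IsPure ↥(idealBefore F k ∩ Set.Iic (F k)) ∧
      rank ↥(idealBefore F k ∩ Set.Iic (F k)) + 1 = rank P
  chordal : ∀ k : Fin m, 0 < (k : ℕ) →
    ∃ φ : Set.Iic (F k) ≃o DualPartitions (Fin (rank P + 1)),
      IsChordal (idealGraph φ (idealBefore F k ∩ Set.Iic (F k)))

/-- `P` has a shelling. -/
def IsShellable (P : Type*) [PartialOrder P] : Prop :=
  ∃ (m : ℕ) (F : Fin m → P), IsShelling F

end PartitionPoset

end

/-! The proof encodes polynomials by falling factorials. Let `fallingEval q` send `t ^ j` to `q (q -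
1) ⋯ (q - j)`; these functionals together separate polynomials. The operator `stirlingOp` becomes
multiplication by `q`, so `resolvent n k`, obtained from `t ^ k` by `n - k` applications, becomes `q
^ (n - k) * q (q - 1) ⋯ (q - k)`. For `k = 0` this is `q ^ (n + 1)`, which identifies row `n` of the
rank matrix with Stirling numbers of the second kind. The recursion then holds with `λ_{n,k} = k +
1`, and the normalization leaves no other choice.

Nonnegativity of `h`: attribute each element of `P` to the first facet above it. Since `I_k` is pure
of corank one in `⟨F_k⟩`, it is generated by partitions with a single block of size two, so the
elements attributed to `F_k` are the partitions of the graph of `I_k` into stable sets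
(`notMem_ideal_iff_isStable`). Their generating polynomial is the chromatic polynomial in falling
factorials. For a chordal graph the latter is a product of factors `q - d`, and each such
multiplication keeps nonnegative combinations of the `R_{n,k}` nonnegative
(`IsNonnegComb.stirlingOp_sub`). The first facet contributes `R_{n,0}` itself, whence `h_0 > 0`.

Real-rootedness: the chain polynomial of `P_S` is the image of the rank generating polynomial under
a linear map `chainMap S` independent of `P`. Fix `z` in the upper half plane and let `L` be
`chainMap S` followed by evaluation at `z`. By induction on `n`, the numbers `L R_{n,0}, …, L
R_{n,n}` have increasing arguments within an angle `arg z - arg (1 + z) < π` (`inSector_resolvent`,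
resting on `InSector.mul_sum_add`). A nonnegative combination with `h_0 > 0` is therefore nonzero at
`z`, and conjugation excludes the lower half plane. -/

noncomputable section

namespace PartitionPoset

/-! ### The resolving polynomials of the matrix of Stirling numbers -/

/-- The operator `f ↦ t f + t f' + f`, which sends row `n` of the matrix `S(n + 1, k + 1)` to row
`n + 1`. -/
def stirlingOp : ℝ[X] →ₗ[ℝ] ℝ[X] :=
  LinearMap.mulLeft ℝ X + LinearMap.mulLeft ℝ X ∘ₗ derivative + LinearMap.id

theorem stirlingOp_apply (f : ℝ[X]) : stirlingOp f = X * f + X * derivative f + f := rfl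

theorem stirlingOp_X_pow (k : ℕ) :
    stirlingOp (X ^ k) = X ^ (k + 1) + C (k + 1 : ℝ) * X ^ k := by
  rw [stirlingOp_apply]
  cases k with
  | zero => simp
  | succ k =>
    simp only [derivative_X_pow, Nat.cast_add, Nat.cast_one, add_tsub_cancel_right, map_add, map_one]
    ring

theorem coeff_stirlingOp (f : ℝ[X]) {k : ℕ} (hk : X ^ k ∣ f) :
    (stirlingOp f).coeff k = (k + 1) * f.coeff k := by
  obtain ⟨g, rfl⟩ := hk
  cases k with
  | zero => simp [stirlingOp_apply]
  | succ k =>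
    rw [stirlingOp_apply, coeff_add, coeff_add, coeff_X_mul, coeff_X_mul, coeff_derivative]
    have : (X ^ (k + 1) * g).coeff k = 0 := by
      rw [coeff_X_pow_mul']; simp
    rw [this]; push_cast; ring

theorem X_pow_dvd_stirlingOp {f : ℝ[X]} {k : ℕ} (hk : X ^ k ∣ f) : X ^ k ∣ stirlingOp f := by
  rw [stirlingOp_apply]
  refine dvd_add (dvd_add (hk.mul_left _) ?_) hk
  obtain ⟨g, rfl⟩ := hk
  cases k with
  | zero => simp
  | succ k =>
    refine ⟨C (k + 1 : ℝ) * g + X * derivative g, ?_⟩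
    rw [derivative_mul, derivative_X_pow]
    simp only [Nat.cast_add, Nat.cast_one, add_tsub_cancel_right, map_add, map_one]
    ring

theorem monic_stirlingOp {f : ℝ[X]} (hf : f.Monic) : (stirlingOp f).Monic := by
  rw [stirlingOp_apply, add_assoc]
  refine (monic_X.mul hf).add_of_left ?_
  have h0 : f.degree ≠ ⊥ := by simpa [degree_eq_bot] using hf.ne_zero
  have hlt : f.degree < (X * f).degree := by
    rw [degree_mul, degree_X, degree_eq_natDegree hf.ne_zero]
    exact_mod_cast Nat.lt_add_of_pos_left one_pos
  refine (degree_add_le _ _).trans_lt (max_lt ?_ hlt)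
  refine lt_of_le_of_lt ?_ hlt
  by_cases hd : derivative f = 0
  · simp [hd]
  rw [degree_mul, degree_X, degree_eq_natDegree hd, degree_eq_natDegree hf.ne_zero]
  have : (derivative f).natDegree < f.natDegree := by
    refine natDegree_derivative_lt fun h => hd ?_
    rw [eq_C_of_natDegree_eq_zero h, derivative_C]
  exact_mod_cast (by omega : 1 + (derivative f).natDegree ≤ f.natDegree)

theorem natDegree_stirlingOp (f : ℝ[X]) :
    (stirlingOp f).natDegree ≤ f.natDegree + 1 := by
  rw [stirlingOp_apply]
  refine natDegree_add_le_of_degree_le (natDegree_add_le_of_degree_le ?_ ?_) (Nat.le_succ _)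
  · exact natDegree_mul_le.trans (by rw [natDegree_X]; omega)
  · refine natDegree_mul_le.trans ?_
    have := natDegree_derivative_le f
    rw [natDegree_X]; omega

/-- The polynomials `R_{n,k}` that resolve the matrix of the infinite dual partition lattice. -/
def resolvent (n k : ℕ) : ℝ[X] := stirlingOp^[n - k] (X ^ k)

theorem resolvent_self (n : ℕ) : resolvent n n = X ^ n := by simp [resolvent]

theorem stirlingOp_resolvent {n k : ℕ} (h : k ≤ n) :
    stirlingOp (resolvent n k) = resolvent (n + 1) k := by
  rw [resolvent, resolvent, Nat.succ_sub h, Function.iterate_succ_apply']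

theorem resolvent_step {n k : ℕ} (h : k ≤ n) :
    resolvent (n + 1) k = resolvent (n + 1) (k + 1) + C (k + 1 : ℝ) * resolvent n k := by
  induction n, h using Nat.le_induction with
  | base =>
    rw [← stirlingOp_resolvent le_rfl, resolvent_self, resolvent_self, stirlingOp_X_pow]
  | succ n h ih =>
    rw [← stirlingOp_resolvent (h.trans n.le_succ)]
    nth_rewrite 1 [ih]
    rw [map_add, stirlingOp_resolvent (Nat.succ_le_succ h), ← smul_eq_C_mul, map_smul,
      stirlingOp_resolvent h, smul_eq_C_mul]

theorem monic_resolvent (n k : ℕ) : (resolvent n k).Monic := by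
  unfold resolvent
  induction n - k with
  | zero => exact monic_X_pow k
  | succ m ih => rw [Function.iterate_succ_apply']; exact monic_stirlingOp ih

theorem natDegree_resolvent {n k : ℕ} (h : k ≤ n) : (resolvent n k).natDegree ≤ n := by
  induction n, h using Nat.le_induction with
  | base => simp [resolvent_self]
  | succ n h ih =>
    rw [← stirlingOp_resolvent h]
    exact (natDegree_stirlingOp _).trans (by omega)

theorem X_pow_dvd_resolvent (n k : ℕ) : X ^ k ∣ resolvent n k := by
  unfold resolvent
  induction n - k with
  | zero => exact dvd_rfl
  | succ m ih => rw [Function.iterate_succ_apply']; exact X_pow_dvd_stirlingOp ih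

theorem coeff_resolvent {n k : ℕ} (h : k ≤ n) :
    (resolvent n k).coeff k = (k + 1 : ℝ) ^ (n - k) := by
  induction n, h using Nat.le_induction with
  | base => simp [resolvent_self]
  | succ n h ih =>
    rw [← stirlingOp_resolvent h, coeff_stirlingOp _ (X_pow_dvd_resolvent n k), ih, Nat.succ_sub h,
      pow_succ']

theorem coeff_resolvent_of_lt {n j k : ℕ} (h : j < k) : (resolvent n k).coeff j = 0 :=
  X_pow_dvd_iff.1 (X_pow_dvd_resolvent n k) j h

/-- The telescoped recursion: row `n + 1` consists of tail sums over row `n` with positive weights,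
all shifted by the same power. The argument estimates use this form. -/
theorem resolvent_succ_eq_sum {n k : ℕ} (h : k ≤ n + 1) :
    resolvent (n + 1) k =
      X ^ (n + 1) + ∑ j ∈ Finset.Ico k (n + 1), C (j + 1 : ℝ) * resolvent n j := by
  induction h using Nat.decreasingInduction with
  | self => simp [resolvent_self]
  | of_succ k hk ih =>
    rw [resolvent_step (Nat.lt_succ_iff.1 hk), ih, Finset.sum_eq_sum_Ico_succ_bot hk]
    ring

/-- In terms of `q` this is the interpolation `q - d = ((k+1-d)/(k+1)) q + (d/(k+1)) (q - (k+1))`.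
Both coefficients are nonnegative exactly when `0 ≤ d ≤ k + 1`. -/
theorem stirlingOp_sub_resolvent {n k : ℕ} (h : k ≤ n) (d : ℝ) :
    stirlingOp (resolvent n k) - C d * resolvent n k =
      C ((k + 1 - d) / (k + 1)) * resolvent (n + 1) k +
        C (d / (k + 1)) * resolvent (n + 1) (k + 1) := by
  have hk : (k + 1 : ℝ) ≠ 0 := by positivity
  have h1 : C d * resolvent n k = C (d / (k + 1)) * (C (k + 1 : ℝ) * resolvent n k) := by
    rw [← mul_assoc, ← C_mul, div_mul_cancel₀ _ hk]
  have h2 : C ((k + 1 - d) / (k + 1)) = 1 - C (d / (k + 1)) := by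
    rw [sub_div, div_self hk, C_sub, C_1]
  rw [h1, h2, stirlingOp_resolvent h, resolvent_step h]
  ring

theorem resolvesWith_resolvent {r : ℕ → ℕ → ℝ}
    (hr : ∀ n, resolvent n 0 = ∑ k ∈ Finset.range (n + 1), C (r n k) * X ^ k) :
    ResolvesWith r resolvent fun _ k => k + 1 where
  nonneg _ _ _ := by positivity
  monic n k _ := monic_resolvent n k
  row := hr
  diag := resolvent_self
  dvd n k _ := X_pow_dvd_resolvent n k
  step _ _ h := resolvent_step h
  vanish _ k _ h := absurd h (by positivity)

/-- The resolving polynomials are unique. -/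
theorem ResolvesWith.eq_resolvent {r : ℕ → ℕ → ℝ} {Rp : ℕ → ℕ → ℝ[X]} {lam : ℕ → ℕ → ℝ}
    (h : ResolvesWith r Rp lam)
    (hr : ∀ n, resolvent n 0 = ∑ k ∈ Finset.range (n + 1), C (r n k) * X ^ k) (k : ℕ) :
    ∀ n, k ≤ n → Rp n k = resolvent n k := by
  induction k with
  | zero => intro n _; rw [h.row, hr]
  | succ k ih =>
    intro n hn
    obtain ⟨m, rfl⟩ : ∃ m, n = m + 1 := ⟨n - 1, by omega⟩
    have hm : k ≤ m := by omega
    have hs := h.step m k hm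
    rw [ih _ hm, ih _ (hm.trans m.le_succ)] at hs
    -- Divisibility by `t ^ (k + 1)` removes the next polynomial from the coefficient of `t ^ k`,
    -- leaving `(k + 1) ^ (m + 1 - k) = λ (k + 1) ^ (m - k)`.
    have hlam : lam m k = k + 1 := by
      have hc := congrArg (fun p => coeff p k) hs
      simp only [coeff_add, coeff_C_mul] at hc
      rw [X_pow_dvd_iff.1 (h.dvd (m + 1) (k + 1) hn) k k.lt_succ_self, coeff_resolvent hm,
        coeff_resolvent (hm.trans m.le_succ), Nat.succ_sub hm, pow_succ', zero_add] at hc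
      exact (mul_right_cancel₀ (by positivity) hc).symm
    rw [hlam, resolvent_step hm] at hs
    exact (add_right_cancel hs).symm

/-- The polynomials `R_{n,k}`, `k ≤ n`, are linearly independent. -/
theorem resolvent_sum_injective {n : ℕ} {a b : Fin (n + 1) → ℝ}
    (h : ∑ k : Fin (n + 1), C (a k) * resolvent n k = ∑ k : Fin (n + 1), C (b k) * resolvent n k) :
    a = b := by
  by_contra hab
  -- At the least index `k` of disagreement, the coefficient of `t ^ k` sees no later polynomial, so
  -- it isolates `a k` and `b k`.
  obtain ⟨k, hk, hmin⟩ := WellFounded.has_min (wellFounded_lt (α := Fin (n + 1)))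
    {k | a k ≠ b k} (Function.ne_iff.1 hab)
  have hc := congrArg (fun p => coeff p k) h
  simp only [finsetSum_coeff, coeff_C_mul] at hc
  rw [← sub_eq_zero, ← Finset.sum_sub_distrib, Finset.sum_eq_single k, coeff_resolvent
    (Nat.lt_succ_iff.1 k.2), ← sub_mul] at hc
  · exact hk (sub_eq_zero.1 ((mul_eq_zero.1 hc).resolve_right (by positivity)))
  · intro j _ hj
    rcases lt_or_gt_of_ne hj with hj | hj
    · rw [not_not.1 fun h => hmin j h hj, sub_self]
    · rw [coeff_resolvent_of_lt hj, mul_zero, mul_zero, sub_self]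
  · simp

/-! ### Evaluation at falling factorials -/

/-- The linear functional sending `t ^ j` to the falling factorial `q (q - 1) ⋯ (q - j)`. -/
def fallingEval (q : ℕ) : ℝ[X] →ₗ[ℝ] ℝ :=
  Polynomial.lsum fun j => LinearMap.mulRight ℝ (q.descFactorial (j + 1) : ℝ)

theorem fallingEval_C_mul_X_pow (q : ℕ) (a : ℝ) (j : ℕ) :
    fallingEval q (C a * X ^ j) = a * q.descFactorial (j + 1) := by
  rw [C_mul_X_pow_eq_monomial]
  exact sum_monomial_index _ _ (zero_mul _)

theorem fallingEval_X_pow (q j : ℕ) : fallingEval q (X ^ j) = q.descFactorial (j + 1) := by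
  simpa using fallingEval_C_mul_X_pow q 1 j

/-- On `t ^ j` this is `q = (q - (j + 1)) + (j + 1)`, multiplied by the falling factorial of length
`j + 1`. -/
theorem fallingEval_stirlingOp (q : ℕ) (f : ℝ[X]) :
    fallingEval q (stirlingOp f) = q * fallingEval q f := by
  induction f using Polynomial.induction_on' with
  | add f g hf hg => rw [map_add, map_add, hf, hg, map_add, mul_add]
  | monomial j a =>
    rw [← C_mul_X_pow_eq_monomial, ← smul_eq_C_mul, map_smul, map_smul, map_smul, stirlingOp_X_pow,
      map_add, fallingEval_C_mul_X_pow, fallingEval_X_pow, fallingEval_X_pow]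
    rw [Nat.descFactorial_succ q (j + 1)]
    rcases le_or_gt (j + 1) q with h | h
    · rw [Nat.cast_mul, Nat.cast_sub h]; simp only [smul_eq_mul]; push_cast; ring
    · rw [Nat.descFactorial_of_lt h]; simp

/-- The system is triangular: at `q = j + 1` the powers above `t ^ j` contribute zero, and the
weight of the coefficient of `t ^ j` is `(j + 1)!`. -/
theorem eq_of_fallingEval_eq {f g : ℝ[X]} (h : ∀ q, fallingEval q f = fallingEval q g) :
    f = g := by
  ext j
  induction j using Nat.strong_induction_on with
  | _ j ih =>
    have hs : ∀ p : ℝ[X], fallingEval (j + 1) p =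
        ∑ i ∈ Finset.range (j + 1), p.coeff i * ((j + 1).descFactorial (i + 1) : ℝ) := by
      intro p
      have : fallingEval (j + 1) p =
          p.sum fun i a => a * ((j + 1).descFactorial (i + 1) : ℝ) := rfl
      rw [this, sum_over_range' _ (by simp) (max (p.natDegree + 1) (j + 1))
        (by omega)]
      refine (Finset.sum_subset (by intro i; simp; omega) fun i _ hi => ?_).symm
      rw [Nat.descFactorial_of_lt (by simpa using hi), Nat.cast_zero, mul_zero]
    have hj := h (j + 1)
    rw [hs, hs, Finset.sum_range_succ, Finset.sum_range_succ, Finset.sum_congr rfl fun i hi => by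
      rw [ih i (Finset.mem_range.1 hi)]] at hj
    exact mul_right_cancel₀ (by rw [Nat.descFactorial_self]; positivity) (add_left_cancel hj)

theorem fallingEval_resolvent_zero (q n : ℕ) : fallingEval q (resolvent n 0) = q ^ (n + 1) := by
  induction n with
  | zero => rw [resolvent_self, fallingEval_X_pow]; simp
  | succ n ih =>
    rw [← stirlingOp_resolvent n.zero_le, fallingEval_stirlingOp, ih, ← pow_succ']

/-! ### Sequences of complex numbers with increasing arguments -/

/-- For `z` in the upper half plane: the angle from `a` to `b` lies between `0` and the angle from
`1 + z` to `z`. -/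
def InSector (z a b : ℂ) : Prop :=
  0 ≤ a.re * b.im - a.im * b.re ∧
    (z.re + z.re ^ 2 + z.im ^ 2) * (a.re * b.im - a.im * b.re) ≤
      z.im * (a.re * b.re + a.im * b.im)

namespace InSector

variable {z a b : ℂ}

theorem self (hz : 0 ≤ z.im) (a : ℂ) : InSector z a a := by
  refine ⟨by linarith, ?_⟩
  have : 0 ≤ z.im * (a.re ^ 2 + a.im ^ 2) := by positivity
  linarith

/-- With `conj a * b = D + i W`, the two conditions read `W ≥ 0` and `Im (z * conj (1 + z) * (D - i
W)) ≥ 0`. They are linear in `a` and in `b` separately, which gives the closure properties below. -/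
theorem add_left {a' : ℂ} (h : InSector z a b) (h' : InSector z a' b) :
    InSector z (a + a') b := by
  refine ⟨?_, ?_⟩ <;> simp only [Complex.add_re, Complex.add_im]
  · linarith [h.1, h'.1]
  · linarith [h.2, h'.2]

theorem add_right {b' : ℂ} (h : InSector z a b) (h' : InSector z a b') :
    InSector z a (b + b') := by
  refine ⟨?_, ?_⟩ <;> simp only [Complex.add_re, Complex.add_im]
  · linarith [h.1, h'.1]
  · linarith [h.2, h'.2]

theorem zero_left : InSector z 0 b := by simp [InSector]

theorem zero_right : InSector z a 0 := by simp [InSector]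

theorem smul_left {c : ℝ} (hc : 0 ≤ c) (h : InSector z a b) : InSector z (c • a) b := by
  refine ⟨?_, ?_⟩ <;> simp only [Complex.smul_re, Complex.smul_im, smul_eq_mul]
  · linarith [mul_nonneg hc h.1]
  · linarith [mul_le_mul_of_nonneg_left h.2 hc]

theorem smul_right {c : ℝ} (hc : 0 ≤ c) (h : InSector z a b) : InSector z a (c • b) := by
  refine ⟨?_, ?_⟩ <;> simp only [Complex.smul_re, Complex.smul_im, smul_eq_mul]
  · linarith [mul_nonneg hc h.1]
  · linarith [mul_le_mul_of_nonneg_left h.2 hc]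

theorem sum_left {ι : Type*} {s : Finset ι} {f : ι → ℂ} (h : ∀ i ∈ s, InSector z (f i) b) :
    InSector z (∑ i ∈ s, f i) b :=
  Finset.sum_induction f (InSector z · b) (fun _ _ => add_left) zero_left h

theorem sum_right {ι : Type*} {s : Finset ι} {f : ι → ℂ} (h : ∀ i ∈ s, InSector z a (f i)) :
    InSector z a (∑ i ∈ s, f i) :=
  Finset.sum_induction f (InSector z a ·) (fun _ _ => add_right) zero_right h

/-- Here `h`, `m`, `t` are head, middle and tail of a row sum. With `u = z h + (1 + z) t` the two
vectors are `u + (1 + z) m` and `u + z m`; as multipliers of `m`, `1 + z` and `z` differ by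
precisely the angle of the sector. -/
theorem mul_sum_add (hz : 0 ≤ z.im) {h m t : ℂ} (hm : InSector z h m) (ht : InSector z h t)
    (hmt : InSector z m t) :
    InSector z (z * (h + m + t) + (m + t)) (z * (h + m + t) + t) := by
  obtain ⟨x, y⟩ := z
  obtain ⟨h₁, h₂⟩ := h
  obtain ⟨m₁, m₂⟩ := m
  obtain ⟨t₁, t₂⟩ := t
  have key : ∀ A B : ℝ, 0 ≤ B → (x + x ^ 2 + y ^ 2) * B ≤ y * A →
      0 ≤ y * A - x * B ∧ 0 ≤ y * A + (1 + x) * B := by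
    intro A B hB hA
    have h1 : 0 ≤ (x ^ 2 + y ^ 2) * B := by positivity
    have h2 : 0 ≤ ((1 + x) ^ 2 + y ^ 2) * B := by positivity
    constructor <;> linarith
  simp only at hz
  obtain ⟨k1, k2⟩ := key _ _ hm.1 hm.2
  obtain ⟨k3, k4⟩ := key _ _ hmt.1 hmt.2
  simp only at k1 k2 k3 k4
  refine ⟨?_, ?_⟩ <;>
    simp only [Complex.add_re, Complex.add_im, Complex.mul_re, Complex.mul_im]
  · have : 0 ≤ y * (m₁ ^ 2 + m₂ ^ 2) := by positivity
    linarith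
  -- The required difference equals `|1 + z|² Im (z m conj t) + |z|² Im ((1 + z) conj h m) + y
  -- |u|²`, with `u = z h + (1 + z) t`.
  · have e1 := mul_nonneg (by positivity : 0 ≤ (1 + x) ^ 2 + y ^ 2) k3
    have e2 := mul_nonneg (by positivity : 0 ≤ x ^ 2 + y ^ 2) k2
    have e3 : 0 ≤ y * ((x * h₁ - y * h₂ + ((1 + x) * t₁ - y * t₂)) ^ 2 +
      (x * h₂ + y * h₁ + ((1 + x) * t₂ + y * t₁)) ^ 2) := by positivity
    linarith

/-- A nonnegative combination of vectors at bounded angles from the first one does not vanish. -/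
theorem sum_ne_zero (hz : 0 < z.im) {ι : Type*} {s : Finset ι} {f : ι → ℂ} {c : ι → ℝ} {i₀ : ι}
    (hi₀ : i₀ ∈ s) (h : ∀ i ∈ s, InSector z (f i₀) (f i)) (hc : ∀ i ∈ s, 0 ≤ c i)
    (hc₀ : 0 < c i₀) (hf : f i₀ ≠ 0) : ∑ i ∈ s, c i • f i ≠ 0 := by
  classical
  intro h0
  have hre := congrArg Complex.re h0
  have him := congrArg Complex.im h0
  simp only [Complex.re_sum, Complex.im_sum, Complex.smul_re, Complex.smul_im, smul_eq_mul,
    Complex.zero_re, Complex.zero_im] at hre him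
  -- If the sum vanished, so would its cross and dot products with `f i₀`. All cross terms are
  -- nonnegative, hence zero; then all dot terms are nonnegative, hence zero, including `c i₀ * |f
  -- i₀|²`.
  have hW : ∑ i ∈ s, c i * ((f i₀).re * (f i).im - (f i₀).im * (f i).re) = 0 := by
    calc _ = (f i₀).re * ∑ i ∈ s, c i * (f i).im - (f i₀).im * ∑ i ∈ s, c i * (f i).re := by
          rw [Finset.mul_sum, Finset.mul_sum, ← Finset.sum_sub_distrib]
          exact Finset.sum_congr rfl fun _ _ => by ring
      _ = 0 := by rw [hre, him]; ring
  have hD : ∑ i ∈ s, z.im * (c i * ((f i₀).re * (f i).re + (f i₀).im * (f i).im)) = 0 := by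
    calc _ = z.im * ((f i₀).re * ∑ i ∈ s, c i * (f i).re +
          (f i₀).im * ∑ i ∈ s, c i * (f i).im) := by
          rw [Finset.mul_sum, Finset.mul_sum, ← Finset.sum_add_distrib, Finset.mul_sum]
          exact Finset.sum_congr rfl fun _ _ => by ring
      _ = 0 := by rw [hre, him]; ring
  have hW' := (Finset.sum_eq_zero_iff_of_nonneg fun i hi => mul_nonneg (hc i hi) (h i hi).1).1 hW
  have hD' := (Finset.sum_eq_zero_iff_of_nonneg fun i hi => ?_).1 hD i₀ hi₀
  · have hpos : 0 < (f i₀).re * (f i₀).re + (f i₀).im * (f i₀).im := Complex.normSq_pos.2 hf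
    exact (mul_pos hz (mul_pos hc₀ hpos)).ne' hD'
  · have := mul_le_mul_of_nonneg_left (h i hi).2 (hc i hi)
    linarith [congrArg ((z.re + z.re ^ 2 + z.im ^ 2) * ·) (hW' i hi)]

end InSector

section Evaluation

variable {z : ℂ} {L : ℝ[X] →ₗ[ℝ] ℂ}

theorem map_C_mul (L : ℝ[X] →ₗ[ℝ] ℂ) (c : ℝ) (p : ℝ[X]) : L (C c * p) = c • L p := by
  rw [← smul_eq_C_mul, map_smul]

theorem map_resolvent_succ {n k : ℕ} (h : k ≤ n + 1) :
    L (resolvent (n + 1) k) =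
      L (X ^ (n + 1)) + ∑ j ∈ Finset.Ico k (n + 1), (j + 1 : ℝ) • L (resolvent n j) := by
  rw [resolvent_succ_eq_sum h, map_add, map_sum]
  simp only [map_C_mul]

/-- The images of the resolving polynomials have increasing arguments if the images of the powers
of `t` obey the recursion of the chain polynomials. -/
theorem inSector_resolvent (hz : 0 < z.im) (h0 : L 1 ≠ 0)
    (hL : ∀ n, L (X ^ (n + 1)) = 0 ∨
      L (X ^ (n + 1)) = z * L (resolvent (n + 1) 0 - X ^ (n + 1))) (n : ℕ) :
    L (resolvent n 0) ≠ 0 ∧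
      ∀ i j, i ≤ j → j ≤ n → InSector z (L (resolvent n i)) (L (resolvent n j)) := by
  induction n with
  | zero =>
    refine ⟨by simpa [resolvent_self] using h0, fun i j hij hj => ?_⟩
    obtain rfl : j = 0 := by omega
    obtain rfl : i = 0 := by omega
    exact InSector.self hz.le _
  | succ n ih =>
    obtain ⟨ihne, ih⟩ := ih
    set f : ℕ → ℂ := fun j => (j + 1 : ℝ) • L (resolvent n j) with hf
    have hff : ∀ i j, i ≤ j → j ≤ n → InSector z (f i) (f j) := fun i j hij hj =>
      ((ih i j hij hj).smul_left (by positivity)).smul_right (by positivity)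
    have hF : ∑ j ∈ Finset.Ico 0 (n + 1), f j ≠ 0 :=
      InSector.sum_ne_zero hz (i₀ := 0) (c := fun j : ℕ => (j + 1 : ℝ))
        (f := fun j => L (resolvent n j)) (by simp)
        (fun i hi => ih 0 i i.zero_le (by simp at hi; omega)) (fun i _ => by positivity)
        (by positivity) ihne
    have hv : ∀ k ≤ n + 1, L (resolvent (n + 1) k) =
        L (X ^ (n + 1)) + ∑ j ∈ Finset.Ico k (n + 1), f j := fun k hk => map_resolvent_succ hk
    have hLn : L (X ^ (n + 1)) = 0 ∨
        L (X ^ (n + 1)) = z * ∑ j ∈ Finset.Ico 0 (n + 1), f j := by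
      refine (hL n).imp_right fun h => ?_
      rw [h, map_sub, hv 0 (Nat.zero_le _), add_sub_cancel_left]
    have hsum : ∀ a b c d, a ≤ b → b ≤ c → c ≤ d → d ≤ n + 1 →
        InSector z (∑ j ∈ Finset.Ico a b, f j) (∑ j ∈ Finset.Ico c d, f j) := by
      intro a b c d _ _ _ _
      refine InSector.sum_left fun i hi => InSector.sum_right fun j hj => hff i j ?_ ?_ <;>
        simp only [Finset.mem_Ico] at hi hj <;> omega
    refine ⟨?_, fun k l hkl hl => ?_⟩
    · rw [hv 0 (Nat.zero_le _)]
      rcases hLn with h | h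
      · rwa [h, zero_add]
      · rw [h, ← add_one_mul]
        refine mul_ne_zero (fun h1 => ?_) hF
        have := congrArg Complex.im h1
        simp at this
        exact hz.ne' this
    -- The sum over row `n` is cut at `k` and `l`. If the new power maps to `0`, only the tails from
    -- `k` and from `l` are compared; otherwise `z` times the whole sum is added to both.
    · rw [hv k (hkl.trans hl), hv l hl, ← Finset.sum_Ico_consecutive f hkl hl]
      rcases hLn with h | h
      · rw [h, zero_add, zero_add]
        exact (hsum k l l (n + 1) hkl le_rfl hl le_rfl).add_left (InSector.self hz.le _)
      · rw [h, ← Finset.sum_Ico_consecutive f (Nat.zero_le l) hl,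
          ← Finset.sum_Ico_consecutive f (Nat.zero_le k) hkl]
        exact InSector.mul_sum_add hz.le (hsum 0 k k l (Nat.zero_le _) le_rfl hkl hl)
          (hsum 0 k l (n + 1) (Nat.zero_le _) hkl hl le_rfl)
          (hsum k l l (n + 1) hkl le_rfl hl le_rfl)

theorem map_sum_resolvent_ne_zero (hz : 0 < z.im) (h0 : L 1 ≠ 0)
    (hL : ∀ n, L (X ^ (n + 1)) = 0 ∨
      L (X ^ (n + 1)) = z * L (resolvent (n + 1) 0 - X ^ (n + 1)))
    {n : ℕ} {h : Fin (n + 1) → ℝ} (hh : ∀ k, 0 ≤ h k) (hh0 : 0 < h 0) :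
    L (∑ k : Fin (n + 1), C (h k) * resolvent n k) ≠ 0 := by
  rw [map_sum]
  simp only [map_C_mul]
  obtain ⟨h1, h2⟩ := inSector_resolvent hz h0 hL n
  exact InSector.sum_ne_zero hz (i₀ := 0) (Finset.mem_univ _)
    (fun i _ => h2 0 i (Nat.zero_le _) (Nat.lt_succ_iff.1 i.2)) (fun i _ => hh i) hh0 h1

end Evaluation

/-- A real polynomial without zeros in the open upper half plane is real-rooted. -/
theorem splits_of_aeval_ne_zero {p : ℝ[X]} (h : ∀ z : ℂ, 0 < z.im → aeval z p ≠ 0) :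
    p.Splits := by
  refine Splits.of_splits_map (algebraMap ℝ ℂ) (IsAlgClosed.splits _) fun z hz => ?_
  have hz0 : aeval z p = 0 := by
    rw [aeval_def, ← eval_map]
    exact (mem_roots'.1 hz).2
  rcases lt_trichotomy z.im 0 with hi | hi | hi
  · refine absurd ?_ (h (starRingEnd ℂ z) (by simpa using hi))
    have := Polynomial.aeval_conj p z
    rw [this, hz0, map_zero]
  · exact ⟨z.re, Complex.ext rfl (by simp [hi])⟩
  · exact absurd hz0 (h z hi)

/-! ### Nonnegative combinations of the resolving polynomials -/

/-- `f` is a nonnegative combination of the polynomials `R_{n,0}, …, R_{n,n}`. -/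
def IsNonnegComb (n : ℕ) (f : ℝ[X]) : Prop :=
  ∃ c : ℕ → ℝ, (∀ k, 0 ≤ c k) ∧ f = ∑ k ∈ Finset.range (n + 1), C (c k) * resolvent n k

namespace IsNonnegComb

variable {n : ℕ}

theorem zero : IsNonnegComb n 0 := ⟨0, fun _ => le_rfl, by simp⟩

theorem add {f g : ℝ[X]} (hf : IsNonnegComb n f) (hg : IsNonnegComb n g) :
    IsNonnegComb n (f + g) := by
  obtain ⟨c, hc, rfl⟩ := hf
  obtain ⟨d, hd, rfl⟩ := hg
  refine ⟨c + d, fun k => add_nonneg (hc k) (hd k), ?_⟩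
  rw [← Finset.sum_add_distrib]
  exact Finset.sum_congr rfl fun k _ => by rw [Pi.add_apply, C_add, add_mul]

theorem sum {ι : Type*} {s : Finset ι} {f : ι → ℝ[X]} (h : ∀ i ∈ s, IsNonnegComb n (f i)) :
    IsNonnegComb n (∑ i ∈ s, f i) :=
  Finset.sum_induction f _ (fun _ _ => add) zero h

theorem C_mul_resolvent {k : ℕ} (hk : k ≤ n) {a : ℝ} (ha : 0 ≤ a) :
    IsNonnegComb n (C a * resolvent n k) := by
  refine ⟨Pi.single k a, fun j => ?_, ?_⟩
  · by_cases h : j = k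
    · subst h; simpa using ha
    · simp [h]
  · rw [Finset.sum_eq_single_of_mem k (Finset.mem_range.2 (Nat.lt_succ_of_le hk))]
    · simp
    · intro j _ hj; simp [hj]

end IsNonnegComb

/-- This is the chromatic polynomial of a complete graph on `k + 1` vertices with `n - k` isolated
vertices added; in particular its values are nonnegative. -/
theorem fallingEval_resolvent {n k : ℕ} (q : ℕ) (h : k ≤ n) :
    fallingEval q (resolvent n k) = q ^ (n - k) * q.descFactorial (k + 1) := by
  induction n, h using Nat.le_induction with
  | base => simp [resolvent_self, fallingEval_X_pow]
  | succ n h ih =>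
    rw [← stirlingOp_resolvent h, fallingEval_stirlingOp, ih, Nat.succ_sub h, pow_succ', mul_assoc]

/-- If `f` vanishes (as a factorial series) at `1, …, d - 1`, then multiplication by `q - d`
preserves nonnegativity. -/
theorem IsNonnegComb.stirlingOp_sub {n d : ℕ} {f : ℝ[X]} (hf : IsNonnegComb n f)
    (hd : ∀ q, 0 < q → q < d → fallingEval q f = 0) :
    IsNonnegComb (n + 1) (stirlingOp f - C (d : ℝ) * f) := by
  obtain ⟨c, hc, rfl⟩ := hf
  have key : stirlingOp (∑ k ∈ Finset.range (n + 1), C (c k) * resolvent n k) -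
      C (d : ℝ) * ∑ k ∈ Finset.range (n + 1), C (c k) * resolvent n k =
      ∑ k ∈ Finset.range (n + 1), (C (c k * ((k + 1 - d) / (k + 1))) * resolvent (n + 1) k +
        C (c k * (d / (k + 1))) * resolvent (n + 1) (k + 1)) := by
    rw [map_sum, Finset.mul_sum, ← Finset.sum_sub_distrib]
    refine Finset.sum_congr rfl fun k hk => ?_
    rw [← smul_eq_C_mul, map_smul, smul_eq_C_mul, smul_eq_C_mul, C_mul, C_mul, mul_assoc,
      mul_assoc, ← mul_add, ← stirlingOp_sub_resolvent (Nat.lt_succ_iff.1 (Finset.mem_range.1 hk))]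
    ring
  rw [key]
  refine IsNonnegComb.sum fun k hk => ?_
  have hk := Nat.lt_succ_iff.1 (Finset.mem_range.1 hk)
  refine (C_mul_resolvent (hk.trans n.le_succ) ?_).add
    (C_mul_resolvent (Nat.succ_le_succ hk) (mul_nonneg (hc k) (by positivity)))
  -- When `k + 1 < d` the interpolation coefficient is negative, but then `c k = 0`: at `q = k + 1`
  -- the values form a vanishing sum of nonnegative terms, and `R_{n,k}` is positive there.
  rcases lt_or_ge (k + 1) d with h | h
  · have h0 := hd (k + 1) k.succ_pos h
    rw [map_sum] at h0
    simp only [← smul_eq_C_mul, map_smul, smul_eq_mul] at h0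
    have := (Finset.sum_eq_zero_iff_of_nonneg fun j hj => mul_nonneg (hc j) (by
      rw [fallingEval_resolvent _ (Nat.lt_succ_iff.1 (Finset.mem_range.1 hj))]
      positivity)).1 h0 k (Finset.mem_range.2 (Nat.lt_succ_of_le hk))
    rw [fallingEval_resolvent _ hk, Nat.descFactorial_self] at this
    rw [(mul_eq_zero.1 this).resolve_right (by positivity), zero_mul]
  · have : (d : ℝ) ≤ k + 1 := by exact_mod_cast h
    exact mul_nonneg (hc k) (div_nonneg (by linarith) (by positivity))

/-! ### Colourings and partitions into stable sets -/

section Colourings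

open Classical in
/-- The colourings of `V` with `q` colours that are proper on the edges of `G` inside `s`. -/
def properOn {V : Type*} [Fintype V] (G : SimpleGraph V) (s : Finset V) (q : ℕ) :
    Finset (V → Fin q) :=
  Finset.univ.filter fun f => ∀ a ∈ s, ∀ b ∈ s, G.Adj a b → f a ≠ f b

variable {V : Type*} [Fintype V] {G : SimpleGraph V}

theorem mem_properOn {s : Finset V} {q : ℕ} {f : V → Fin q} :
    f ∈ properOn G s q ↔ ∀ a ∈ s, ∀ b ∈ s, G.Adj a b → f a ≠ f b := by
  simp [properOn]

open Classical in
theorem injOn_of_mem_properOn {s t : Finset V} {q : ℕ} {f : V → Fin q} (hf : f ∈ properOn G s q)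
    (ht : t ⊆ s) (hclique : G.IsClique (t : Set V)) : Set.InjOn f t := by
  intro a ha b hb hab
  by_contra hne
  exact mem_properOn.1 hf a (ht ha) b (ht hb) (hclique ha hb hne) hab

theorem mem_properOn_cons {s : Finset V} {q : ℕ} {v : V} (hv : v ∉ s) {f : V → Fin q} :
    f ∈ properOn G (Finset.cons v s hv) q ↔
      f ∈ properOn G s q ∧ ∀ w ∈ s, G.Adj v w → f w ≠ f v := by
  rw [mem_properOn, mem_properOn]
  constructor
  · intro h
    exact ⟨fun a ha b hb => h a (Finset.mem_cons_of_mem ha) b (Finset.mem_cons_of_mem hb),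
      fun w hw hvw => (h v (Finset.mem_cons_self v s) w (Finset.mem_cons_of_mem hw) hvw).symm⟩
  · rintro ⟨h1, h2⟩ a ha b hb hab
    rcases Finset.mem_cons.1 ha with rfl | ha' <;> rcases Finset.mem_cons.1 hb with rfl | hb'
    · exact absurd rfl hab.ne
    · exact (h2 b hb' hab).symm
    · exact h2 a ha' hab.symm
    · exact h1 a ha' b hb' hab

-- The neighbours of `v` in `s` form a clique, so a colouring proper on `s` gives them distinct
-- colours and forbids exactly that many colours at `v`. Colourings are defined on all of `V`, with
-- `v` still free in those proper on `s`; this accounts for the factor `q` on the left.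
open Classical in
theorem card_properOn_cons {s : Finset V} {q : ℕ} {v : V} (hv : v ∉ s)
    (hclique : G.IsClique {w | w ∈ s ∧ G.Adj v w}) :
    (q : ℝ) * (properOn G (Finset.cons v s hv) q).card =
      (q - (s.filter (G.Adj v)).card) * (properOn G s q).card := by
  have hcl : G.IsClique ((s.filter (G.Adj v) : Finset V) : Set V) := by
    simpa using hclique
  have hne : ∀ w ∈ s, w ≠ v := fun w hw h => hv (h ▸ hw)
  have hupd : ∀ (f : V → Fin q) (c : Fin q),
      Function.update f v c ∈ properOn G s q ↔ f ∈ properOn G s q := by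
    intro f c
    rw [mem_properOn, mem_properOn]
    refine forall₂_congr fun a ha => forall₂_congr fun b hb => ?_
    rw [Function.update_of_ne (hne a ha), Function.update_of_ne (hne b hb)]
  -- The bijection exchanges the colour of `v` with a spare colour.
  have hbij : (properOn G (Finset.cons v s hv) q ×ˢ (Finset.univ : Finset (Fin q))).card =
      ((properOn G s q).sigma fun g => Finset.univ \ (s.filter (G.Adj v)).image g).card := by
    refine Finset.card_nbij' (fun p => ⟨Function.update p.1 v p.2, p.1 v⟩)
      (fun p => (Function.update p.1 v p.2, p.1 v)) ?_ ?_ ?_ ?_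
    · rintro ⟨f, c⟩ h
      simp only [Finset.coe_product, Set.mem_prod, Finset.mem_coe, mem_properOn_cons] at h
      simp only [Finset.mem_coe, Finset.mem_sigma, hupd, Finset.mem_sdiff, Finset.mem_univ,
        true_and, Finset.mem_image, Finset.mem_filter, not_exists, not_and]
      refine ⟨h.1.1, fun w hw => ?_⟩
      rw [Function.update_of_ne (hne w hw.1)]
      exact h.1.2 w hw.1 hw.2
    · rintro ⟨g, c⟩ h
      simp only [Finset.mem_coe, Finset.mem_sigma, Finset.mem_sdiff, Finset.mem_univ,
        true_and, Finset.mem_image, Finset.mem_filter, not_exists, not_and] at h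
      simp only [Finset.coe_product, Set.mem_prod, Finset.mem_coe, mem_properOn_cons, hupd,
        Finset.mem_univ, and_true]
      refine ⟨h.1, fun w hw hvw => ?_⟩
      rw [Function.update_of_ne (hne w hw), Function.update_self]
      exact h.2 w ⟨hw, hvw⟩
    · rintro ⟨f, c⟩ _
      simp
    · rintro ⟨g, c⟩ _
      simp
  have hcard : ((properOn G (Finset.cons v s hv) q).card : ℝ) * q =
      ∑ g ∈ properOn G s q, ((q : ℝ) - (s.filter (G.Adj v)).card) := by
    rw [Finset.card_product, Finset.card_sigma, Finset.card_univ, Fintype.card_fin] at hbij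
    rw [← Nat.cast_mul, hbij, Nat.cast_sum]
    refine Finset.sum_congr rfl fun g hg => ?_
    have hi := Finset.card_image_of_injOn
      (injOn_of_mem_properOn hg (Finset.filter_subset _ _) hcl)
    have hle : (s.filter (G.Adj v)).card ≤ q := by
      rw [← hi]; simpa using Finset.card_le_univ ((s.filter (G.Adj v)).image g)
    rw [← Finset.compl_eq_univ_sdiff, Finset.card_compl, Fintype.card_fin, hi, Nat.cast_sub hle]
  rw [mul_comm, hcard, Finset.sum_const, nsmul_eq_mul, mul_comm]

/-- The chromatic polynomial of a chordal graph, written in falling factorials, corresponds to a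
nonnegative combination of resolving polynomials. -/
theorem IsChordalOn.exists_isNonnegComb {s : Finset V} (h : IsChordalOn G s) :
    ∀ n, s.card = n + 1 → ∃ f, IsNonnegComb n f ∧
      ∀ q : ℕ, (q : ℝ) ^ (n + 1) * (properOn G s q).card =
        q ^ Fintype.card V * fallingEval q f := by
  classical
  induction h with
  | empty => intro n hn; simp at hn
  | cons v s hv hclique hs ih =>
    intro n hn
    rw [Finset.card_cons, Nat.add_right_cancel_iff] at hn
    have hcons := fun q : ℕ => card_properOn_cons (q := q) hv hclique
    cases n with
    -- The induction starts at one vertex, whose chromatic polynomial `q` corresponds to `R_{0,0} =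
    -- 1`.
    | zero =>
      obtain rfl := Finset.card_eq_zero.1 hn
      refine ⟨resolvent 0 0, by
        simpa using IsNonnegComb.C_mul_resolvent (n := 0) le_rfl zero_le_one, fun q => ?_⟩
      have hall : properOn G ∅ q = Finset.univ := by ext; simp [mem_properOn]
      rw [zero_add, pow_one, hcons, hall, fallingEval_resolvent_zero]
      simp [mul_comm]
    | succ n =>
      obtain ⟨f, hf, hfq⟩ := ih n hn
      refine ⟨_, hf.stirlingOp_sub (d := (s.filter (G.Adj v)).card) fun q hq hqd => ?_,
        fun q => ?_⟩
      -- Fewer than `d` colours cannot colour a clique of size `d`, so the vanishing hypothesis of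
      -- `stirlingOp_sub` holds.
      · have h0 : properOn G s q = ∅ := by
          refine Finset.eq_empty_of_forall_notMem fun g hg => ?_
          have hi := Finset.card_image_of_injOn
            (injOn_of_mem_properOn (t := s.filter (G.Adj v)) hg (Finset.filter_subset _ _)
              (by simpa using hclique))
          have := Finset.card_le_univ ((s.filter (G.Adj v)).image g)
          rw [hi, Fintype.card_fin] at this
          omega
        have := hfq q
        rw [h0, Finset.card_empty, Nat.cast_zero, mul_zero, eq_comm] at this
        exact (mul_eq_zero.1 this).resolve_left (by positivity)
      · rw [map_sub, fallingEval_stirlingOp, ← smul_eq_C_mul, map_smul, smul_eq_mul, ← sub_mul,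
          pow_succ, mul_assoc, hcons, mul_left_comm, hfq]
        ring

variable (G) in
/-- The partition into the classes of `σ` has stable blocks. -/
def IsStable (σ : Setoid V) : Prop := ∀ a b, G.Adj a b → ¬ σ a b

-- A colouring with kernel `σ` is an injection of the blocks of `σ` into the colours.
open Classical in
theorem card_filter_ker_eq (σ : Setoid V) (q : ℕ) :
    (Finset.univ.filter fun f : V → Fin q => Setoid.ker f = σ).card =
      q.descFactorial (Nat.card (Quotient σ)) := by
  have hemb := Fintype.card_embedding_eq (α := Quotient σ) (β := Fin q)
  rw [Fintype.card_fin] at hemb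
  rw [Nat.card_eq_fintype_card, ← hemb, ← Finset.card_univ]
  refine (Finset.card_bij (fun (e : Quotient σ ↪ Fin q) _ => e ∘ Quotient.mk σ) ?_ ?_ ?_).symm
  · intro e _
    simp only [Finset.mem_filter, Finset.mem_univ, true_and]
    ext a b
    simp [Setoid.ker_def, Quotient.eq]
  · intro e _ e' _ h
    ext x
    induction x using Quotient.inductionOn with
    | h a => exact congrArg Fin.val (congrFun h a)
  · intro f hf
    simp only [Finset.mem_filter, Finset.mem_univ, true_and] at hf
    subst hf
    exact ⟨⟨Quotient.lift f fun _ _ h => h, fun x y => Quotient.inductionOn₂ x y fun a b h =>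
      Quotient.sound h⟩, Finset.mem_univ _, rfl⟩

open Classical in
theorem card_properOn_univ [Fintype (Setoid V)] (q : ℕ) :
    (properOn G Finset.univ q).card = ∑ σ : Setoid V with IsStable G σ,
      q.descFactorial (Nat.card (Quotient σ)) := by
  rw [Finset.card_eq_sum_card_fiberwise (f := fun f : V → Fin q => Setoid.ker f)
    (t := Finset.univ.filter (IsStable G))]
  · refine Finset.sum_congr rfl fun σ hσ => ?_
    rw [← card_filter_ker_eq]
    congr 1
    ext f
    simp only [Finset.mem_filter, Finset.mem_univ, true_and, and_iff_right_iff_imp]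
    rintro rfl
    exact mem_properOn.2 fun a _ b _ hab => (Finset.mem_filter.1 hσ).2 a b hab
  · intro f hf
    simp only [Finset.coe_filter, Finset.mem_univ, true_and, Set.mem_ofPred_eq]
    exact fun a b hab => mem_properOn.1 hf a (Finset.mem_univ a) b (Finset.mem_univ b) hab

open Classical in
theorem fallingEval_sum_stable [Nonempty V] [Fintype (Setoid V)] (q : ℕ) :
    fallingEval q (∑ σ : Setoid V with IsStable G σ, X ^ (Nat.card (Quotient σ) - 1)) =
      (properOn G Finset.univ q).card := by
  rw [card_properOn_univ, map_sum, Nat.cast_sum]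
  refine Finset.sum_congr rfl fun σ _ => ?_
  have : Nonempty (Quotient σ) := ⟨Quotient.mk σ (Classical.arbitrary V)⟩
  rw [fallingEval_X_pow, Nat.sub_add_cancel Nat.card_pos]

open Classical in
/-- The generating polynomial of the partitions of the vertices of a chordal graph into stable
sets is a nonnegative combination of resolving polynomials. -/
theorem IsChordal.isNonnegComb [Fintype (Setoid V)] {n : ℕ} (h : IsChordal G)
    (hn : Fintype.card V = n + 1) :
    IsNonnegComb n (∑ σ : Setoid V with IsStable G σ, X ^ (Nat.card (Quotient σ) - 1)) := by
  have : Nonempty V := Fintype.card_pos_iff.1 (by omega)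
  obtain ⟨f, hf, hfq⟩ := IsChordalOn.exists_isNonnegComb h n hn
  convert hf
  refine eq_of_fallingEval_eq fun q => ?_
  rw [fallingEval_sum_stable]
  -- The factor `q ^ (n + 1)` can be cancelled only for `q > 0`; at `q = 0` both sides vanish.
  rcases Nat.eq_zero_or_pos q with rfl | hq
  · have : IsEmpty (V → Fin 0) := ⟨fun f => (f (Classical.arbitrary V)).elim0⟩
    have h0 : fallingEval 0 f = f.sum fun i a => a * ((0 : ℕ).descFactorial (i + 1) : ℝ) := rfl
    rw [h0, Finset.eq_empty_of_isEmpty (properOn G Finset.univ 0)]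
    simp [Polynomial.sum]
  · have := hfq q
    rw [hn] at this
    exact mul_left_cancel₀ (by positivity) this

/-- The generating polynomial of all partitions of `n + 1` points is the row polynomial. -/
theorem sum_setoid_eq_resolvent [Fintype (Setoid V)] {n : ℕ} (hn : Fintype.card V = n + 1) :
    ∑ σ : Setoid V, (X : ℝ[X]) ^ (Nat.card (Quotient σ) - 1) = resolvent n 0 := by
  classical
  have : Nonempty V := Fintype.card_pos_iff.1 (by omega)
  refine eq_of_fallingEval_eq fun q => ?_
  have h := fallingEval_sum_stable (G := (⊥ : SimpleGraph V)) q
  -- In the graph without edges every partition is stable and every colouring is proper.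
  have h1 : (Finset.univ.filter (IsStable (⊥ : SimpleGraph V))) = Finset.univ := by
    ext σ; simp [IsStable]
  have h2 : properOn (⊥ : SimpleGraph V) Finset.univ q = Finset.univ := by
    ext f; simp [mem_properOn]
  rw [h1, h2] at h
  rw [h, fallingEval_resolvent_zero, ← hn]
  simp

end Colourings

/-! ### Ranks -/

section Rank

variable {Q A : Type*} [PartialOrder Q] [PartialOrder A]

theorem rk_orderIso (e : Q ≃o A) (x : Q) : rk (e x) = rk x := by
  rw [rk, rk, Order.height_orderIso]

theorem rk_coe_of_isLowerSet {I : Set Q} (hI : IsLowerSet I) (x : I) : rk (x : Q) = rk x := by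
  rw [rk, rk, ← Order.height_eq_of_strictMono (Subtype.val : I → Q) (fun _ _ h => h)]
  exact fun a b h => ⟨⟨b, hI h.le a.2⟩, h, rfl⟩

theorem rk_coe_Iic {x : Q} (z : Set.Iic x) : rk (z : Q) = rk z :=
  rk_coe_of_isLowerSet (isLowerSet_Iic x) z

theorem height_eq_of_strictMono_nat {f : Q → ℕ} (hf : StrictMono f)
    (hstep : ∀ x, f x ≠ 0 → ∃ y < x, f y + 1 = f x) (x : Q) : Order.height x = f x := by
  refine le_antisymm ?_ ?_
  · simpa using Order.height_le_height_apply_of_strictMono f hf x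
  · generalize hn : f x = n
    induction n generalizing x with
    | zero => simp
    | succ n ih =>
      obtain ⟨y, hyx, hy⟩ := hstep x (by omega)
      have := ih y (by omega)
      push_cast
      exact (add_le_add_left this 1).trans (Order.height_add_one_le hyx)

theorem height_lt_top_of_finite [Finite Q] (x : Q) : Order.height x < ⊤ := by
  have hf : StrictMono fun x : Q => (Set.Iio x).ncard := fun x y h =>
    Set.ncard_lt_ncard ⟨Set.Iio_subset_Iio h.le, fun h' => lt_irrefl x (h' h)⟩ (Set.toFinite _)
  have := Order.height_le_height_apply_of_strictMono _ hf x
  rw [Order.height_nat] at this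
  exact this.trans_lt (ENat.natCast_lt_top _)

theorem rk_strictMono [Finite Q] : StrictMono (rk : Q → ℕ) := fun x y h => by
  rw [← Nat.cast_lt (α := ℕ∞), rk, rk, ENat.natCast_toNat (height_lt_top_of_finite x).ne,
    ENat.natCast_toNat (height_lt_top_of_finite y).ne]
  exact Order.height_strictMono h (height_lt_top_of_finite x)

theorem rk_le_rank [Finite Q] (x : Q) : rk x ≤ rank Q :=
  le_csSup (Set.finite_range _).bddAbove ⟨x, rfl⟩

theorem rk_eq_rank_of_isMax [Finite Q] (hQ : IsPure Q) {x : Q} (hx : IsMax x) :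
    rk x = rank Q := by
  obtain ⟨y, hy⟩ := Nat.sSup_mem (s := Set.range (rk : Q → ℕ)) ⟨_, x, rfl⟩
    (Set.finite_range _).bddAbove
  obtain ⟨w, hyw, hw⟩ := Finite.exists_le_maximal (p := fun _ : Q => True) (a := y) trivial
  have hwmax : IsMax w := fun v hv => hw.2 trivial hv
  rw [hQ x w hx hwmax]
  exact le_antisymm (rk_le_rank w) (hy.symm.le.trans (rk_strictMono.monotone hyw))

theorem exists_isMax_ge [Finite Q] (x : Q) : ∃ y, x ≤ y ∧ IsMax y := by
  obtain ⟨w, hxw, hw⟩ := Finite.exists_le_maximal (p := fun _ : Q => True) (a := x) trivial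
  exact ⟨w, hxw, fun v hv => hw.2 trivial hv⟩

theorem ncard_le_rk_eq {x : Q} (e : Set.Iic x ≃o A) (k : ℕ) :
    {z | z ≤ x ∧ rk z = k}.ncard = {a : A | rk a = k}.ncard := by
  refine Set.ncard_congr (fun z hz => e ⟨z, hz.1⟩) ?_ ?_ ?_
  · intro z hz
    change rk (e _) = k
    rw [rk_orderIso, ← rk_coe_Iic]; exact hz.2
  · intro z w hz hw h
    exact congrArg Subtype.val (e.injective h)
  · intro a ha
    refine ⟨e.symm a, ⟨(e.symm a).2, ?_⟩, e.apply_symm_apply a⟩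
    rw [rk_coe_Iic, rk_orderIso]; exact ha

theorem rk_top_Iic {x : Q} (e : Set.Iic x ≃o A) {a : A} (ha : IsTop a) : rk x = rk a := by
  have h : e.symm a = ⟨x, le_rfl⟩ := by
    refine le_antisymm (e.symm a).2 ?_
    rw [e.le_symm_apply]
    exact ha _
  rw [← rk_orderIso e.symm a, h, ← rk_coe_Iic]

end Rank

/-! ### The lattice of partitions -/

section Partitions

theorem finite_setoid (V : Type*) [Finite V] : Finite (Setoid V) :=
  Finite.of_injective (fun σ : Setoid V => (σ : V → V → Prop)) fun _ _ h =>
    Setoid.ext fun a b => iff_of_eq (congrFun (congrFun h a) b)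

variable {α : Type*}

theorem finite_quotient_of_le {σ τ : Setoid α} [Finite (Quotient σ)] (h : σ ≤ τ) :
    Finite (Quotient τ) :=
  Finite.of_surjective (Quotient.map' id h : Quotient σ → Quotient τ)
    (fun x => Quotient.inductionOn x fun a => ⟨Quotient.mk σ a, rfl⟩)

theorem card_quotient_lt {σ τ : Setoid α} [Finite (Quotient σ)] (h : σ < τ) :
    Nat.card (Quotient τ) < Nat.card (Quotient σ) := by
  have := finite_quotient_of_le h.le
  have := Fintype.ofFinite (Quotient σ)
  have := Fintype.ofFinite (Quotient τ)
  rw [Nat.card_eq_fintype_card, Nat.card_eq_fintype_card]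
  refine Fintype.card_lt_of_surjective_not_injective
    (Quotient.map' id h.le : Quotient σ → Quotient τ)
    (fun x => Quotient.inductionOn x fun a => ⟨Quotient.mk σ a, rfl⟩) fun hinj => ?_
  refine h.not_ge fun a b hab => Quotient.exact (hinj (a₁ := Quotient.mk σ a)
    (a₂ := Quotient.mk σ b) ?_)
  exact Quotient.sound hab

theorem exists_card_quotient_succ {σ : Setoid α} [Finite (Quotient σ)]
    (h : 1 < Nat.card (Quotient σ)) :
    ∃ τ, σ < τ ∧ Nat.card (Quotient τ) + 1 = Nat.card (Quotient σ) := by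
  classical
  obtain ⟨x, y, hxy⟩ := (Finite.one_lt_card_iff_nontrivial.1 h).exists_pair_ne
  -- The kernel of `g` merges block `y` into block `x`.
  set g : α → Quotient σ := fun c => if Quotient.mk σ c = y then x else Quotient.mk σ c with hg
  have hrange : Set.range g = {y}ᶜ := by
    ext w
    simp only [Set.mem_range, Set.mem_compl_iff, Set.mem_singleton_iff, hg]
    constructor
    · rintro ⟨c, rfl⟩
      split_ifs with hc
      · exact hxy
      · exact hc
    · intro hw
      obtain ⟨c, rfl⟩ := Quotient.exists_rep w
      exact ⟨c, if_neg hw⟩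
  have hcard : Nat.card (Quotient (Setoid.ker g)) + 1 = Nat.card (Quotient σ) := by
    rw [Nat.card_congr (Setoid.quotientKerEquivRange g), hrange, Nat.card_coe_set_eq, add_comm,
      ← Set.ncard_singleton y, Set.ncard_add_ncard_compl]
  have hle : σ ≤ Setoid.ker g := fun a b hab => by
    have : Quotient.mk σ a = Quotient.mk σ b := Quotient.sound hab
    simp only [Setoid.ker_def, hg, this]
  refine ⟨Setoid.ker g, lt_of_le_of_ne hle fun heq => ?_, hcard⟩
  rw [← heq] at hcard
  omega

theorem nonempty_quotient [Nonempty α] (σ : Setoid α) : Nonempty (Quotient σ) :=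
  ⟨Quotient.mk σ (Classical.arbitrary α)⟩

theorem rk_add_one_eq_card [Finite α] [Nonempty α] (π : DualPartitions α) :
    rk π + 1 = Nat.card (Quotient (OrderDual.ofDual π)) := by
  have hpos : ∀ σ : Setoid α, 0 < Nat.card (Quotient σ) := fun σ =>
    have := nonempty_quotient σ
    Nat.card_pos
  have h := height_eq_of_strictMono_nat (Q := DualPartitions α)
    (f := fun π => Nat.card (Quotient (OrderDual.ofDual π)) - 1) (fun σ τ h => ?_)
    (fun σ h => ?_) π
  · rw [rk, h, ENat.toNat_natCast]
    have := hpos (OrderDual.ofDual π)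
    omega
  · have := card_quotient_lt (σ := OrderDual.ofDual τ) (τ := OrderDual.ofDual σ) h
    have := hpos (OrderDual.ofDual σ)
    simp only
    omega
  · obtain ⟨τ, h1, h2⟩ := exists_card_quotient_succ (σ := OrderDual.ofDual σ) (by omega)
    refine ⟨OrderDual.toDual τ, h1, ?_⟩
    have := hpos τ
    simp only [OrderDual.ofDual_toDual]
    omega

/-- The partitions coarser than `π` are the partitions of the set of blocks of `π`. -/
def iicOrderIso (π : InfDualPartitions) :
    Set.Iic π ≃o DualPartitions (Quotient (OrderDual.ofDual π.1)) where
  toFun z := OrderDual.toDual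
    (Setoid.correspondence (OrderDual.ofDual π.1) ⟨OrderDual.ofDual z.1.1, z.2⟩)
  invFun s :=
    have := π.2
    ⟨⟨OrderDual.toDual
      ((Setoid.correspondence (OrderDual.ofDual π.1)).symm (OrderDual.ofDual s)).1,
      finite_quotient_of_le
        ((Setoid.correspondence (OrderDual.ofDual π.1)).symm (OrderDual.ofDual s)).2⟩,
      ((Setoid.correspondence (OrderDual.ofDual π.1)).symm (OrderDual.ofDual s)).2⟩
  left_inv z := by
    apply Subtype.ext
    apply Subtype.ext
    simp
  right_inv s := by simp
  map_rel_iff' {a b} := (Setoid.correspondence (OrderDual.ofDual π.1)).map_rel_iff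

/-- Relabelling of the points. -/
def dualPartitionsCongr {β : Type*} (e : α ≃ β) : DualPartitions α ≃o DualPartitions β where
  toFun s := OrderDual.toDual (Setoid.comap e.symm (OrderDual.ofDual s))
  invFun s := OrderDual.toDual (Setoid.comap e (OrderDual.ofDual s))
  left_inv s := by
    refine congrArg OrderDual.toDual (Setoid.ext fun a b => ?_)
    change OrderDual.ofDual s (e.symm (e a)) (e.symm (e b)) ↔ _
    rw [e.symm_apply_apply, e.symm_apply_apply]
    rfl
  right_inv s := by
    refine congrArg OrderDual.toDual (Setoid.ext fun a b => ?_)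
    change OrderDual.ofDual s (e (e.symm a)) (e (e.symm b)) ↔ _
    rw [e.apply_symm_apply, e.apply_symm_apply]
    rfl
  map_rel_iff' {s t} := by
    constructor
    · intro h a b hab
      have h' : OrderDual.ofDual t (e.symm (e a)) (e.symm (e b)) →
        OrderDual.ofDual s (e.symm (e a)) (e.symm (e b)) := @h (e a) (e b)
      rw [e.symm_apply_apply, e.symm_apply_apply] at h'
      exact h' hab
    · exact fun h a b hab => h hab

theorem exists_iicOrderIso_of_inf (π : InfDualPartitions) :
    Nonempty (Set.Iic π ≃o DualPartitions (Fin (rk π + 1))) := by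
  have := π.2
  have := nonempty_quotient (OrderDual.ofDual π.1)
  have htop : IsTop (OrderDual.toDual (⊥ : Setoid (Quotient (OrderDual.ofDual π.1)))) :=
    fun s => (bot_le : ⊥ ≤ OrderDual.ofDual s)
  have hcard : Nat.card (Quotient (OrderDual.ofDual π.1)) = rk π + 1 := by
    rw [rk_top_Iic (iicOrderIso π) htop, rk_add_one_eq_card]
    exact Nat.card_congr (Equiv.ofBijective (Quotient.mk ⊥)
      ⟨fun a b h => Quotient.exact h, Quotient.mk_surjective⟩)
  rw [← hcard]
  exact ⟨(iicOrderIso π).trans (dualPartitionsCongr (Finite.equivFin _))⟩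

theorem rk_toDual_bot (n : ℕ) : rk (OrderDual.toDual (⊥ : Setoid (Fin (n + 1)))) = n := by
  have h := rk_add_one_eq_card (OrderDual.toDual (⊥ : Setoid (Fin (n + 1))))
  have : Nat.card (Quotient (⊥ : Setoid (Fin (n + 1)))) = n + 1 := by
    rw [← Nat.card_congr (Equiv.ofBijective (Quotient.mk (⊥ : Setoid (Fin (n + 1))))
      ⟨fun a b h => Quotient.exact h, Quotient.mk_surjective⟩), Nat.card_fin]
  rw [OrderDual.ofDual_toDual, this] at h
  omega

theorem isTop_toDual_bot (n : ℕ) : IsTop (OrderDual.toDual (⊥ : Setoid (Fin (n + 1)))) :=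
  fun s => (bot_le : ⊥ ≤ OrderDual.ofDual s)

theorem exists_iicOrderIso {P : Type*} [PartialOrder P] (hP : IsPartitionPoset P) (x : P) :
    Nonempty (Set.Iic x ≃o DualPartitions (Fin (rk x + 1))) := by
  obtain ⟨y, ⟨e⟩⟩ := hP x
  obtain ⟨e'⟩ := exists_iicOrderIso_of_inf y
  have : rk x = rk y := by
    rw [rk_top_Iic (e.trans e') (isTop_toDual_bot _), rk_toDual_bot]
  rw [this]
  exact ⟨e.trans e'⟩

theorem exists_rk_eq (n : ℕ) : ∃ π : InfDualPartitions, rk π = n := by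
  set g : ℕ+ → Fin (n + 1) := fun x => Fin.ofNat (n + 1) x with hg
  have hsurj : Function.Surjective g := fun i =>
    -- The blocks are the residue classes modulo `n + 1`; adding `n + 1` keeps the representative of
    -- `0` positive.
    ⟨⟨i + (n + 1), by omega⟩, Fin.ext (by simp [hg, Fin.ofNat, Nat.mod_eq_of_lt i.2])⟩
  have e : Quotient (Setoid.ker g) ≃ Fin (n + 1) := Setoid.quotientKerEquivOfSurjective g hsurj
  set π : InfDualPartitions := ⟨OrderDual.toDual (Setoid.ker g), Finite.of_equiv _ e.symm⟩
  exact ⟨π, by rw [rk_top_Iic ((iicOrderIso π).trans (dualPartitionsCongr e))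
    (isTop_toDual_bot n), rk_toDual_bot]⟩

theorem rankMatrix_eq (n k : ℕ) :
    rankMatrix InfDualPartitions n k = {σ : DualPartitions (Fin (n + 1)) | rk σ = k}.ncard := by
  have h := exists_rk_eq n
  rw [rankMatrix, dif_pos h]
  obtain ⟨e⟩ := exists_iicOrderIso_of_inf h.choose
  rw [ncard_le_rk_eq e, h.choose_spec]

theorem ncard_le_rk_eq_rankMatrix {P : Type*} [PartialOrder P] (hP : IsPartitionPoset P) (x : P)
    (k : ℕ) : {z | z ≤ x ∧ rk z = k}.ncard = rankMatrix InfDualPartitions (rk x) k := by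
  obtain ⟨e⟩ := exists_iicOrderIso hP x
  rw [ncard_le_rk_eq e, rankMatrix_eq]

theorem resolvent_zero_eq (n : ℕ) : resolvent n 0 = ∑ k ∈ Finset.range (n + 1),
    C (rankMatrix InfDualPartitions n k : ℝ) * X ^ k := by
  classical
  have := finite_setoid (Fin (n + 1))
  have := Fintype.ofFinite (Setoid (Fin (n + 1)))
  have hrk : ∀ σ : Setoid (Fin (n + 1)),
      Nat.card (Quotient σ) - 1 = rk (OrderDual.toDual σ) := fun σ => by
    have := rk_add_one_eq_card (OrderDual.toDual σ)
    rw [OrderDual.ofDual_toDual] at this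
    omega
  rw [← sum_setoid_eq_resolvent (V := Fin (n + 1)) (Fintype.card_fin _),
    ← Finset.sum_fiberwise_of_maps_to (t := Finset.range (n + 1))
      (g := fun σ : Setoid (Fin (n + 1)) => rk (OrderDual.toDual σ))]
  · refine Finset.sum_congr rfl fun k _ => ?_
    rw [Finset.sum_congr rfl fun σ hσ => by rw [hrk, (Finset.mem_filter.1 hσ).2],
      Finset.sum_const, nsmul_eq_mul, rankMatrix_eq]
    congr 1
    rw [← Set.ncard_coe_finset, map_natCast]
    congr 1
    exact Set.ncard_congr (fun σ _ => OrderDual.toDual σ) (by simp) (by simp) (by simp)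
  · intro σ _
    have := rk_strictMono.monotone (isTop_toDual_bot n (OrderDual.toDual σ))
    rw [rk_toDual_bot] at this
    simpa [Nat.lt_succ_iff] using this

end Partitions

/-! ### Shellings -/

section Shelling

variable {P : Type*} [PartialOrder P]

theorem isLowerSet_idealBefore {m : ℕ} (F : Fin m → P) (k : Fin m) :
    IsLowerSet (idealBefore F k) := fun _ _ hba ⟨j, hj, ha⟩ => ⟨j, hj, hba.trans ha⟩

open Classical in
theorem sum_iic_eq_sum_setoid [Fintype P] {n : ℕ} [Fintype (Setoid (Fin (n + 1)))] {x : P}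
    (φ : Set.Iic x ≃o DualPartitions (Fin (n + 1))) {p : P → Prop}
    {s : Setoid (Fin (n + 1)) → Prop} (h : ∀ σ, p (φ.symm (OrderDual.toDual σ)) ↔ s σ) :
    ∑ z : P with z ≤ x ∧ p z, (X : ℝ[X]) ^ rk z =
      ∑ σ : Setoid (Fin (n + 1)) with s σ, X ^ (Nat.card (Quotient σ) - 1) := by
  refine (Finset.sum_bij (fun σ _ => (φ.symm (OrderDual.toDual σ) : P)) ?_ ?_ ?_ ?_).symm
  · intro σ hσ
    simp only [Finset.mem_filter, Finset.mem_univ, true_and] at hσ ⊢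
    exact ⟨(φ.symm (OrderDual.toDual σ)).2, (h σ).2 hσ⟩
  · intro σ _ τ _ hστ
    exact OrderDual.toDual.injective (φ.symm.injective (Subtype.ext hστ))
  · intro z hz
    simp only [Finset.mem_filter, Finset.mem_univ, true_and] at hz
    have hφ : φ.symm (OrderDual.toDual (OrderDual.ofDual (φ ⟨z, hz.1⟩))) = ⟨z, hz.1⟩ :=
      φ.symm_apply_apply _
    refine ⟨OrderDual.ofDual (φ ⟨z, hz.1⟩), ?_, by rw [hφ]⟩
    rw [Finset.mem_filter, ← h, hφ]
    exact ⟨Finset.mem_univ _, hz.2⟩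
  · intro σ _
    have := rk_add_one_eq_card (OrderDual.toDual σ)
    rw [OrderDual.ofDual_toDual] at this
    rw [rk_coe_Iic, rk_orderIso, ← this, Nat.add_sub_cancel]

theorem le_pairPartition {α : Type*} {σ : Setoid α} {i j : α} (h : σ i j) :
    OrderDual.toDual σ ≤ pairPartition i j := by
  rintro a b (rfl | ⟨ha, hb⟩)
  · exact σ.refl a
  · rcases ha with rfl | rfl <;> rcases hb with rfl | rfl
    · exact σ.refl _
    · exact h
    · exact σ.symm h
    · exact σ.refl _

/-- The elements below `F k` outside the ideal of the earlier facets are the partitions into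
stable sets of the graph of that ideal. -/
theorem notMem_ideal_iff_isStable [Finite P] {n : ℕ} {x : P} {I : Set P} (hI : IsLowerSet I)
    (hIx : I ⊆ Set.Iic x) (hpure : IsPure I) (hrank : rank I + 1 = n)
    (φ : Set.Iic x ≃o DualPartitions (Fin (n + 1))) (σ : Setoid (Fin (n + 1))) :
    (φ.symm (OrderDual.toDual σ) : P) ∉ I ↔ IsStable (idealGraph φ I) σ := by
  have := finite_setoid (Fin (n + 1))
  rw [← not_iff_not, not_not, IsStable]
  push Not
  constructor
  · intro hσ
    obtain ⟨⟨y, hyI⟩, hy, hmax⟩ := exists_isMax_ge (⟨_, hσ⟩ : I)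
    have hrk : rk y + 1 = n := by
      rw [← hrank, ← rk_eq_rank_of_isMax hpure hmax]
      exact congrArg (· + 1) (rk_coe_of_isLowerSet hI ⟨y, hyI⟩)
    have hφrk : rk (φ ⟨y, hIx hyI⟩) + 1 = n := by
      rw [rk_orderIso, ← rk_coe_Iic]; exact hrk
    set τ : Setoid (Fin (n + 1)) := OrderDual.ofDual (φ ⟨y, hIx hyI⟩) with hτ
    have hτ' : OrderDual.toDual τ = φ ⟨y, hIx hyI⟩ := rfl
    obtain ⟨i, j, hij, hne⟩ : ∃ i j, τ i j ∧ i ≠ j := by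
      by_contra hcon
      push Not at hcon
      have hb : τ = ⊥ := le_bot_iff.1 fun a b hab => hcon a b hab
      rw [← hτ', hb, rk_toDual_bot] at hφrk
      omega
    have hle : OrderDual.toDual τ ≤ pairPartition i j := le_pairPartition hij
    have hlt : rk (pairPartition i j) < n := by
      have h1 : pairPartition i j < OrderDual.toDual (⊥ : Setoid (Fin (n + 1))) := by
        refine lt_of_le_of_ne (isTop_toDual_bot n _) fun h => hne ?_
        have h2 : OrderDual.ofDual (pairPartition i j) i j :=
          Or.inr ⟨Set.mem_insert _ _, Set.mem_insert_of_mem _ rfl⟩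
        rw [h] at h2
        exact h2
      have h3 := rk_strictMono h1
      rwa [rk_toDual_bot] at h3
    -- The maximal element above `σ` has rank `n - 1` and lies below a pair partition, itself of
    -- rank less than `n`, so the two coincide.
    have heq : pairPartition i j = φ ⟨y, hIx hyI⟩ := by
      by_contra hcon
      have := rk_strictMono (lt_of_le_of_ne hle (Ne.symm hcon))
      rw [hτ'] at this
      omega
    refine ⟨i, j, ⟨hne, ?_⟩, ?_⟩
    · rw [heq, φ.symm_apply_apply]; exact hyI
    · have h1 : OrderDual.toDual σ ≤ φ ⟨y, hIx hyI⟩ := by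
        rw [← φ.symm_apply_le]; exact hy
      exact h1 hij
  · rintro ⟨i, j, ⟨_, hmem⟩, hσ⟩
    exact hI (φ.symm.monotone (le_pairPartition hσ)) hmem

open Classical in
theorem isNonnegComb_sum_facet [Fintype P] {m : ℕ} {F : Fin m → P} (hF : IsShelling F)
    {k : Fin m} (hk : 0 < (k : ℕ)) :
    IsNonnegComb (rank P) (∑ z : P with z ≤ F k ∧ z ∉ idealBefore F k, (X : ℝ[X]) ^ rk z) := by
  have := finite_setoid (Fin (rank P + 1))
  have := Fintype.ofFinite (Setoid (Fin (rank P + 1)))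
  obtain ⟨φ, hφ⟩ := hF.chordal k hk
  obtain ⟨hpure, hrank⟩ := hF.pure k hk
  have h := hφ.isNonnegComb (Fintype.card_fin _)
  rw [← sum_iic_eq_sum_setoid φ (p := fun z => z ∉ idealBefore F k) fun σ => ?_] at h
  · convert h
  · rw [← notMem_ideal_iff_isStable ((isLowerSet_idealBefore F k).inter (isLowerSet_Iic _))
      Set.inter_subset_right hpure hrank]
    exact not_congr (and_iff_left (φ.symm (OrderDual.toDual σ)).2).symm

theorem sum_first_facet [Fintype P] (hP : IsPartitionPoset P) {x : P} (hx : rk x = rank P)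
    [DecidablePred fun z => z ≤ x] :
    ∑ z : P with z ≤ x, (X : ℝ[X]) ^ rk z = resolvent (rank P) 0 := by
  classical
  have := finite_setoid (Fin (rank P + 1))
  have := Fintype.ofFinite (Setoid (Fin (rank P + 1)))
  obtain ⟨φ⟩ := exists_iicOrderIso hP x
  rw [hx] at φ
  have h := sum_iic_eq_sum_setoid φ (p := fun _ => True) (s := fun _ => True) fun _ => Iff.rfl
  simp only [and_true, Finset.filter_true] at h
  rw [← sum_setoid_eq_resolvent (V := Fin (rank P + 1)) (Fintype.card_fin _), ← h]

/-- The rank generating polynomial of a shellable partition poset is the row polynomial plus a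
nonnegative combination of resolving polynomials. -/
theorem exists_rankGenPoly_eq [Finite P] [Nonempty P] (hP : IsPartitionPoset P)
    (hpure : IsPure P) (hshell : IsShellable P) :
    ∃ f, IsNonnegComb (rank P) f ∧ rankGenPoly P = resolvent (rank P) 0 + f := by
  classical
  have := Fintype.ofFinite P
  obtain ⟨m, F, hF⟩ := hshell
  have hcover : ∀ x : P, ∃ k, x ≤ F k ∧ x ∉ idealBefore F k := by
    intro x
    obtain ⟨y, hxy, hy⟩ := exists_isMax_ge x
    obtain ⟨k, rfl⟩ : y ∈ Set.range F := by rw [hF.range_eq]; exact hy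
    obtain ⟨l, hl, hmin⟩ := WellFounded.has_min (wellFounded_lt (α := Fin m)) {k | x ≤ F k}
      ⟨k, hxy⟩
    exact ⟨l, hl, fun ⟨j, hj, hxj⟩ => hmin j hxj hj⟩
  -- `g x` is the first facet above `x`; its fibres partition `P`.
  choose g hg using hcover
  have hgk : ∀ x k, g x = k ↔ x ≤ F k ∧ x ∉ idealBefore F k := by
    refine fun x k => ⟨fun h => h ▸ hg x, fun ⟨h1, h2⟩ => ?_⟩
    rcases lt_trichotomy (g x) k with h | h | h
    · exact absurd ⟨g x, h, (hg x).1⟩ h2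
    · exact h
    · exact absurd ⟨k, h, h1⟩ (hg x).2
  have hm : 0 < m := (Nat.zero_le _).trans_lt (g (Classical.arbitrary P)).2
  obtain ⟨m, rfl⟩ : ∃ m', m = m' + 1 := ⟨m - 1, by omega⟩
  refine ⟨∑ k : Fin m, ∑ z : P with z ≤ F k.succ ∧ z ∉ idealBefore F k.succ, X ^ rk z,
    IsNonnegComb.sum fun k _ => isNonnegComb_sum_facet hF (by simp), ?_⟩
  rw [rankGenPoly, finsum_eq_sum_of_fintype, ← Finset.sum_fiberwise Finset.univ g]
  simp only [hgk]
  rw [Fin.sum_univ_succ]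
  congr 1
  have h0 : ∀ z, z ∉ idealBefore F 0 := fun z ⟨j, hj, _⟩ => absurd hj (Fin.not_lt_zero j)
  simp only [h0, not_false_eq_true, and_true]
  refine sum_first_facet hP (rk_eq_rank_of_isMax hpure ?_)
  have : F 0 ∈ Set.range F := ⟨0, rfl⟩
  rw [hF.range_eq] at this
  exact this

theorem isHVector_iff [Finite P] {h : Fin (rank P + 1) → ℝ} :
    IsHVector P h ↔ rankGenPoly P = ∑ k : Fin (rank P + 1), C (h k) * resolvent (rank P) k := by
  constructor
  · rintro ⟨Rp, ⟨lam, hR⟩, hP⟩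
    rw [hP]
    refine Finset.sum_congr rfl fun k _ => ?_
    rw [hR.eq_resolvent resolvent_zero_eq k _ (Nat.lt_succ_iff.1 k.2)]
  · exact fun h => ⟨resolvent, ⟨_, resolvesWith_resolvent resolvent_zero_eq⟩, h⟩

theorem exists_isHVector [Finite P] [Nonempty P] (hP : IsPartitionPoset P)
    (hpure : IsPure P) (hshell : IsShellable P) :
    ∃ h : Fin (rank P + 1) → ℝ, IsHVector P h ∧ (∀ k, 0 ≤ h k) ∧ 0 < h 0 := by
  obtain ⟨f, ⟨c, hc, rfl⟩, hf⟩ := exists_rankGenPoly_eq hP hpure hshell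
  refine ⟨fun k => c k + if k = 0 then 1 else 0, isHVector_iff.2 ?_, fun k => ?_, ?_⟩
  · rw [hf, Finset.sum_range]
    simp only [C_add, add_mul, Finset.sum_add_distrib]
    rw [add_comm]
    congr 1
    rw [Finset.sum_eq_single 0] <;> simp +contextual
  · exact add_nonneg (hc k) (by split_ifs <;> norm_num)
  · exact add_pos_of_nonneg_of_pos (hc _) (by simp)

end Shelling

/-! ### Chain polynomials -/

section Chains

variable {P : Type*} [PartialOrder P]

open Classical in
/-- The generating polynomial of the chains contained in `T`, by their size. -/
def chainSum (T : Finset P) : ℝ[X] :=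
  ∑ C ∈ T.powerset.filter fun C : Finset P => IsChain (· ≤ ·) (C : Set P), X ^ C.card

theorem chainPoly_eq_chainSum {Q : Type*} [PartialOrder Q] [Fintype Q] (e : Q ↪o P) :
    chainPoly Q = chainSum (Finset.univ.map e.toEmbedding) := by
  classical
  have := Fintype.ofFinite {C : Finset Q // IsChain (· ≤ ·) (C : Set Q)}
  have hchain : ∀ C : Finset Q, IsChain (· ≤ ·) ((C.map e.toEmbedding : Finset P) : Set P) ↔
      IsChain (· ≤ ·) (C : Set Q) := by
    intro C
    rw [Finset.coe_map]
    constructor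
    · intro h a ha b hb hab
      have := h (Set.mem_image_of_mem _ ha) (Set.mem_image_of_mem _ hb)
        (fun h => hab (e.toEmbedding.injective h))
      simpa using this
    · rintro h _ ⟨a, ha, rfl⟩ _ ⟨b, hb, rfl⟩ hab
      have := h ha hb fun h => hab (by rw [h])
      simpa using this
  rw [chainPoly, finsum_eq_sum_of_fintype, chainSum]
  refine Finset.sum_bij (fun C _ => C.1.map e.toEmbedding) ?_ ?_ ?_ ?_
  · intro C _
    rw [Finset.mem_filter, Finset.mem_powerset]
    exact ⟨Finset.map_subset_map.2 (Finset.subset_univ _), (hchain _).2 C.2⟩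
  · intro C _ D _ h
    exact Subtype.ext (Finset.map_injective _ h)
  · intro D hD
    rw [Finset.mem_filter, Finset.mem_powerset] at hD
    obtain ⟨C, _, rfl⟩ := Finset.subset_map_iff.1 hD.1
    exact ⟨⟨C, (hchain C).1 hD.2⟩, Finset.mem_univ _, rfl⟩
  · intro C _
    rw [Finset.card_map]

open Classical in
theorem chainPoly_rankSelected [Fintype P] (S : Set ℕ) :
    chainPoly (RankSelected P S) = chainSum (Finset.univ.filter fun x : P => rk x ∈ S) := by
  rw [chainPoly_eq_chainSum (OrderEmbedding.subtype fun x : P => rk x ∈ S)]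
  congr 1
  ext x
  simp

theorem chainPoly_eq_chainSum_univ [Fintype P] :
    chainPoly P = chainSum (Finset.univ : Finset P) := by
  rw [chainPoly_eq_chainSum (OrderIso.refl P).toOrderEmbedding]
  congr 1
  ext x
  simp

open Classical in
/-- Nonempty chains are classified by their largest elements. -/
theorem chainSum_eq (T : Finset P) :
    chainSum T = 1 + ∑ x ∈ T, X * chainSum (T.filter (· < x)) := by
  have hempty : (∅ : Finset P) ∈ T.powerset.filter fun C : Finset P => IsChain (· ≤ ·) (C : Set P) := by
    simp
  rw [chainSum, ← Finset.add_sum_erase _ _ hempty, Finset.card_empty, pow_zero]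
  congr 1
  simp only [chainSum, Finset.mul_sum]
  rw [Finset.sum_sigma']
  have hlt : ∀ p : (_ : P) × Finset P, p ∈ (T.sigma fun x =>
      (T.filter (· < x)).powerset.filter fun C : Finset P => IsChain (· ≤ ·) (C : Set P)) ↔
      p.1 ∈ T ∧ (∀ y ∈ p.2, y ∈ T ∧ y < p.1) ∧ IsChain (· ≤ ·) (p.2 : Set P) := by
    intro p
    simp [Finset.subset_iff]
  refine (Finset.sum_bij (fun p _ => insert p.1 p.2) ?_ ?_ ?_ ?_).symm
  · rintro ⟨x, D⟩ hp
    obtain ⟨hx, hD, hchain⟩ := (hlt _).1 hp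
    simp only [Finset.mem_erase, Finset.mem_filter, Finset.mem_powerset]
    refine ⟨Finset.insert_ne_empty _ _, Finset.insert_subset hx fun y hy => (hD y hy).1, ?_⟩
    rw [Finset.coe_insert]
    exact hchain.insert fun y hy _ => Or.inr (hD y hy).2.le
  · rintro ⟨x, D⟩ hp ⟨x', D'⟩ hp' h
    obtain ⟨hx, hD, -⟩ := (hlt _).1 hp
    obtain ⟨hx', hD', -⟩ := (hlt _).1 hp'
    simp only at h hx hD hx' hD'
    have h1 : x ≤ x' := by
      have : x ∈ insert x' D' := h ▸ Finset.mem_insert_self x D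
      rcases Finset.mem_insert.1 this with h | h
      · exact h.le
      · exact (hD' x h).2.le
    have h2 : x' ≤ x := by
      have : x' ∈ insert x D := h ▸ Finset.mem_insert_self x' D'
      rcases Finset.mem_insert.1 this with h | h
      · exact h.le
      · exact (hD x' h).2.le
    obtain rfl := le_antisymm h1 h2
    have hn : x ∉ D := fun h => lt_irrefl x (hD x h).2
    have hn' : x ∉ D' := fun h => lt_irrefl x (hD' x h).2
    rw [← Finset.erase_insert hn, h, Finset.erase_insert hn']
  · intro C hC
    simp only [Finset.mem_erase, Finset.mem_filter, Finset.mem_powerset] at hC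
    obtain ⟨hne, hCT, hchain⟩ := hC
    obtain ⟨x, hx⟩ := C.exists_maximal (Finset.nonempty_iff_ne_empty.2 hne)
    refine ⟨⟨x, C.erase x⟩, (hlt _).2 ⟨hCT hx.1, fun y hy => ?_, ?_⟩, Finset.insert_erase hx.1⟩
    · have hyC := Finset.mem_of_mem_erase hy
      have hyx := Finset.ne_of_mem_erase hy
      refine ⟨hCT hyC, lt_of_le_of_ne ?_ hyx⟩
      rcases hchain hyC hx.1 hyx with h | h
      · exact h
      · exact hx.2 hyC h
    · exact hchain.mono (by simp)
  · rintro ⟨x, D⟩ hp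
    obtain ⟨-, hD, -⟩ := (hlt _).1 hp
    rw [Finset.card_insert_of_notMem fun h => lt_irrefl x (hD x h).2, pow_succ']

/-- The chain polynomial of the elements strictly below an element of rank `n` whose ranks lie
in `S`. -/
def intervalPoly (S : Set ℕ) (n : ℕ) : ℝ[X] :=
  open Classical in
  1 + ∑ k : Fin n, if (k : ℕ) ∈ S then
    C (rankMatrix InfDualPartitions n k : ℝ) * (X * intervalPoly S k) else 0
termination_by n
decreasing_by exact k.2

-- The elements below `x` of each rank are counted by the rank matrix, so by induction the
-- polynomial depends only on the rank of `x`.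
open Classical in
theorem chainSum_filter_lt [Fintype P] (hP : IsPartitionPoset P) (S : Set ℕ) (x : P) :
    chainSum ((Finset.univ.filter fun y : P => rk y ∈ S).filter (· < x)) =
      intervalPoly S (rk x) := by
  induction hn : rk x using Nat.strong_induction_on generalizing x with
  | _ n ih =>
    subst hn
    rw [chainSum_eq, intervalPoly]
    congr 1
    rw [Finset.sum_congr rfl (g := fun y => X * intervalPoly S (rk y)) fun y hy => by
      have hyx := (Finset.mem_filter.1 hy).2
      rw [← ih _ (rk_strictMono hyx) y rfl]
      congr 2
      ext w
      simp only [Finset.mem_filter, Finset.mem_univ, true_and]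
      exact ⟨fun h => ⟨h.1.1, h.2⟩, fun h => ⟨⟨h.1, h.2.trans hyx⟩, h.2⟩⟩]
    rw [← Finset.sum_fiberwise_of_maps_to (t := Finset.range (rk x)) (g := rk)
      fun y hy => Finset.mem_range.2 (rk_strictMono (Finset.mem_filter.1 hy).2),
      Finset.sum_range]
    refine Finset.sum_congr rfl fun k _ => ?_
    rw [Finset.sum_congr rfl (g := fun _ => X * intervalPoly S k) fun y hy => by
      rw [(Finset.mem_filter.1 hy).2], Finset.sum_const, nsmul_eq_mul]
    split_ifs with hk
    · rw [← ncard_le_rk_eq_rankMatrix hP, map_natCast, ← Set.ncard_coe_finset]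
      congr 3
      ext y
      simp only [Finset.coe_filter, Finset.mem_filter, Finset.mem_univ, true_and,
        Set.mem_ofPred_eq]
      constructor
      · exact fun h => ⟨h.1.2.le, h.2⟩
      · rintro ⟨hyx, hy⟩
        refine ⟨⟨hy ▸ hk, lt_of_le_of_ne hyx fun h => ?_⟩, hy⟩
        rw [h] at hy
        exact k.2.ne hy.symm
    · rw [Finset.card_eq_zero.2, Nat.cast_zero, zero_mul]
      refine Finset.eq_empty_of_forall_notMem fun y hy => hk ?_
      simp only [Finset.mem_filter, Finset.mem_univ, true_and] at hy
      exact hy.2 ▸ hy.1.1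

open Classical in
/-- The contribution of an element of rank `k` to the chain polynomial: chains with largest
element there, and the empty chain, which is attributed to the least element. -/
def rankWeight (S : Set ℕ) (k : ℕ) : ℝ[X] :=
  (if k = 0 then 1 else 0) + if k ∈ S then X * intervalPoly S k else 0

/-- The linear map sending `t ^ k` to the contribution of an element of rank `k`. -/
def chainMap (S : Set ℕ) : ℝ[X] →ₗ[ℝ] ℝ[X] :=
  Polynomial.lsum fun k => LinearMap.toSpanSingleton ℝ ℝ[X] (rankWeight S k)

theorem chainMap_C_mul_X_pow (S : Set ℕ) (a : ℝ) (k : ℕ) :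
    chainMap S (C a * X ^ k) = C a * rankWeight S k := by
  rw [C_mul_X_pow_eq_monomial, ← smul_eq_C_mul]
  exact sum_monomial_index _ _ (zero_smul _ _)

theorem chainMap_X_pow (S : Set ℕ) (k : ℕ) : chainMap S (X ^ k) = rankWeight S k := by
  simpa using chainMap_C_mul_X_pow S 1 k

theorem rk_eq_zero_iff [Finite P] [OrderBot P] {x : P} : rk x = 0 ↔ x = ⊥ := by
  constructor
  · intro h
    by_contra hx
    have := rk_strictMono (bot_lt_iff_ne_bot.2 hx)
    omega
  · rintro rfl
    simp [rk]

-- Chains are sorted by their largest element, whose weight depends only on its rank; the empty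
-- chain goes to `⊥`, the only element of rank zero, whether or not `0 ∈ S`.
open Classical in
theorem chainMap_rankGenPoly [Fintype P] [OrderBot P] (hP : IsPartitionPoset P) (S : Set ℕ) :
    chainMap S (rankGenPoly P) = chainSum (Finset.univ.filter fun x : P => rk x ∈ S) := by
  rw [rankGenPoly, finsum_eq_sum_of_fintype, map_sum, chainSum_eq]
  simp only [chainMap_X_pow, rankWeight, Finset.sum_add_distrib, rk_eq_zero_iff,
    chainSum_filter_lt hP]
  rw [Finset.sum_filter]
  simp

theorem rankMatrix_zero (n : ℕ) : rankMatrix InfDualPartitions n 0 = 1 := by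
  have h := coeff_resolvent n.zero_le
  rw [resolvent_zero_eq] at h
  simpa [finsetSum_coeff, coeff_X_pow] using h

/-- Deleting the leading power from the row polynomial leaves the elements strictly below one of
rank `n + 1`. This is the recursion required by `inSector_resolvent`. -/
theorem chainMap_resolvent_sub (S : Set ℕ) (n : ℕ) :
    chainMap S (resolvent (n + 1) 0 - X ^ (n + 1)) = intervalPoly S (n + 1) := by
  classical
  have h1 : C (rankMatrix InfDualPartitions (n + 1) (n + 1) : ℝ) = 1 := by
    have h := congrArg (fun p => coeff p (n + 1)) (resolvent_zero_eq (n + 1))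
    simp only [resolvent_succ_eq_sum (Nat.zero_le (n + 1)), coeff_add, finsetSum_coeff,
      coeff_C_mul] at h
    rw [Finset.sum_eq_zero fun j hj => by
      rw [coeff_eq_zero_of_natDegree_lt (Nat.lt_succ_of_le (natDegree_resolvent
        (Nat.lt_succ_iff.1 (Finset.mem_Ico.1 hj).2))), mul_zero]] at h
    simp only [coeff_X_pow, if_true, add_zero, mul_ite, mul_one, mul_zero, Finset.sum_ite_eq,
      Finset.mem_range, Nat.lt_succ_self] at h
    rw [← h, C_1]
  rw [resolvent_zero_eq, Finset.sum_range_succ, h1, one_mul, add_sub_cancel_right, map_sum,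
    Finset.sum_range, intervalPoly]
  simp only [chainMap_C_mul_X_pow, rankWeight, mul_add, Finset.sum_add_distrib]
  congr 1
  · rw [Finset.sum_eq_single 0]
    · simp [rankMatrix_zero]
    · intro k _ hk
      have hk0 : (k : ℕ) ≠ 0 := fun h => hk (Fin.ext h)
      rw [if_neg hk0, mul_zero]
    · simp
  · exact Finset.sum_congr rfl fun k _ => by rw [mul_ite, mul_zero]

/-- The chain polynomials of rank selections of `P` are real-rooted if the `h`-vector of `P` is
nonnegative. -/
theorem splits_chainSum [Fintype P] [OrderBot P] (hP : IsPartitionPoset P)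
    {h : Fin (rank P + 1) → ℝ} (hh : IsHVector P h) (hnn : ∀ k, 0 ≤ h k) (h0 : 0 < h 0)
    (S : Set ℕ) [DecidablePred fun x : P => rk x ∈ S] :
    (chainSum (Finset.univ.filter fun x : P => rk x ∈ S)).Splits := by
  refine splits_of_aeval_ne_zero fun z hz => ?_
  have key := map_sum_resolvent_ne_zero (L := (aeval z).toLinearMap ∘ₗ chainMap S) hz ?_
    (fun n => ?_) hnn h0
  · rw [← isHVector_iff.1 hh, LinearMap.comp_apply, chainMap_rankGenPoly hP] at key
    convert key using 1
    rw [AlgHom.toLinearMap_apply]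
    congr!
  · rw [← pow_zero X, LinearMap.comp_apply, chainMap_X_pow, rankWeight, if_pos rfl]
    split_ifs
    · have : intervalPoly S 0 = 1 := by rw [intervalPoly]; simp
      rw [this]
      intro h
      have := congrArg Complex.im h
      simp at this
      exact hz.ne' this
    · simp
  · rw [LinearMap.comp_apply, LinearMap.comp_apply, chainMap_resolvent_sub, chainMap_X_pow,
      rankWeight, if_neg n.succ_ne_zero, zero_add]
    split_ifs
    · exact Or.inr (by simp)
    · exact Or.inl (by simp)

end Chains

end PartitionPoset

end

open PartitionPoset in
/-- A shellable pure partition poset has a (unique) `h`-vector and it is nonnegative, and the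
chain polynomials of the poset and of its rank selected subposets are real-rooted. -/
theorem corollary9 (P : Type*) [PartialOrder P] [OrderBot P] [Finite P]
    (hP : IsPartitionPoset P) (hpure : IsPure P) (hshell : IsShellable P) :
    (∃! h : Fin (rank P + 1) → ℝ, IsHVector P h) ∧
    (∀ h : Fin (rank P + 1) → ℝ, IsHVector P h → ∀ k, 0 ≤ h k) ∧
    (chainPoly P).Splits ∧
    ∀ S : Set ℕ, (chainPoly (RankSelected P S)).Splits := by
  classical
  have := Fintype.ofFinite P
  obtain ⟨h, hh, hnn, h0⟩ := exists_isHVector hP hpure hshell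
  have huniq : ∀ h' : Fin (rank P + 1) → ℝ, IsHVector P h' → h' = h := fun h' hh' =>
    resolvent_sum_injective ((isHVector_iff.1 hh').symm.trans (isHVector_iff.1 hh))
  refine ⟨⟨h, hh, huniq⟩, fun h' hh' k => huniq h' hh' ▸ hnn k, ?_, fun S => ?_⟩
  · rw [chainPoly_eq_chainSum_univ]
    simpa using splits_chainSum hP hh hnn h0 Set.univ
  · rw [chainPoly_rankSelected]
    exact splits_chainSum hP hh hnn h0 S
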